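/- All graphs are finite, simple and connected. For a graph $G$ write $$AZI(G)=\sum_{uv\in E(G)}\left(\frac{d(u)d(v)}{d(u)+d(v)-2}\right)^3 .$$ For $k\ge 1$, a $k$-apex tree is a connected graph $G$ such that $G-X$ is a tree for some $X\subset V(G)$ with $|X|=k$, while $G-X$ is not a tree for any $X\subset V(G)$ with $|X|<k$. Let $\mathcal U_n^k$ be the class of unicyclic graphs (connected, with as many edges as vertices) on $n$ vertices that are $k$-apex trees. For $q\ge 5$ let $Z_q$ be the unique tree on $q$ vertices with $q-2$ pendant vertices, one vertex of degree $2$ and one vertex of degree $q-2$; its special pendant vertex is the pendant vertex adjacent to the vertex of degree $2$. Let $Z_4=P_4$, both of whose end vertices are called special. Consider unicyclic graphs whose cycle is a triangle $u_1u_2u_3$, with a tree $T_{u_i}$ hanging at each $u_i$ (so that $u_i\in V(T_{u_i})$). - $A_{s_1,s_2,s_3}$ ($s_i\ge 4$): each $T_{u_i}$ is $Z_{s_i}$ with $u_i$ a special pendant vertex. - $B_{s_1,s_2,s_3}$ ($s_1\ge 2$, $s_2,s_3\ge 4$): $T_{u_1}=K_{1,s_1-1}$ with center $u_1$, and for $i=2,3$,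 $T_{u_i}=Z_{s_i}$ with $u_i$ a special pendant vertex. - $C_{s_1,s_2,s_3}$ ($s_1\ge 2$, $s_2\ge 3$, $s_3\ge 4$): $T_{u_1}=K_{1,s_1-1}$ with center $u_1$; $T_{u_2}=K_{1,s_2-1}$ with $u_2$ a pendant vertex of it; $T_{u_3}=Z_{s_3}$ with $u_3$ a special pendant vertex. **Proposition 3.1.** Let $k\ge 4$ and $n\ge 3k+3$. Then, up to isomorphism, the unique graph with minimum $AZI$ in $\mathcal U_n^k$ is $$\begin{cases} A_{k,\lfloor (n-k)/2\rfloor,\lceil (n-k)/2\rceil} & \text{if } k\ge 7,\\ B_{6,\lfloor n/2\rfloor-3,\lceil n/2\rceil-3} & \text{if } k=6,\\ C_{k,k,n-2k} & \text{if } 4\le k\le 5.\end{cases}$$ That is, a graph has minimum $AZI$ in $\mathcal U_n^k$ if and only if it is isomorphic to the graph displayed. -/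

import Mathlib

open Classical in
/-- The augmented Zagreb index
`AZI(G) = ∑_{uv ∈ E(G)} (d(u) d(v) / (d(u) + d(v) - 2))³`, as a real number. -/
noncomputable def augmentedZagrebIndex {V : Type*} [Fintype V] (G : SimpleGraph V) : ℝ :=
  ∑ e ∈ G.edgeFinset,
    Sym2.lift ⟨fun u v =>
      (((G.degree u : ℝ) * (G.degree v : ℝ)) / ((G.degree u : ℝ) + (G.degree v : ℝ) - 2)) ^ 3,
      fun u v => by
        dsimp only
        rw [mul_comm (G.degree u : ℝ), add_comm (G.degree u : ℝ)]⟩ e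

/-- `G` is a `k`-apex tree: `G` is connected, some `k`-subset `X` of the vertices has `G - X` a
tree, and `G - X` is not a tree for any set `X` of fewer than `k` vertices. -/
def IsApexTree {V : Type*} (k : ℕ) (G : SimpleGraph V) : Prop :=
  G.Connected ∧
  (∃ X : Finset V, X.card = k ∧ (G.induce {v | v ∉ X}).IsTree) ∧
  ∀ X : Finset V, X.card < k → ¬ (G.induce {v | v ∉ X}).IsTree

/-- A unicyclic graph: a connected graph with as many edges as vertices. -/
def IsUnicyclic {V : Type*} (G : SimpleGraph V) : Prop :=
  G.Connected ∧ G.edgeSet.ncard = Nat.card V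

/-- The class of unicyclic `k`-apex trees on the vertex set `V`. -/
def unicyclicApexTrees (V : Type*) (k : ℕ) : Set (SimpleGraph V) :=
  {G | IsUnicyclic G ∧ IsApexTree k G}

/-- `G` has minimum augmented Zagreb index in the class of graphs `S`. -/
def HasMinAZI {V : Type*} [Fintype V] (S : Set (SimpleGraph V)) (G : SimpleGraph V) : Prop :=
  G ∈ S ∧ ∀ H ∈ S, augmentedZagrebIndex G ≤ augmentedZagrebIndex H

/-! Rooted trees: the vertices are `0, …, q - 1`, and the root is always the vertex `0`. -/

/-- The star `K_{1,q-1}`, rooted at its center (`q ≥ 1`): the vertex `0` is joined to all others. -/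
def centerStar (q : ℕ) : SimpleGraph (Fin q) :=
  SimpleGraph.fromRel fun i _ => i.val = 0

/-- The star `K_{1,q-1}`, rooted at a pendant vertex (`q ≥ 3`): the vertex `1` is joined to all
others, and the root is the pendant vertex `0`. -/
def leafStar (q : ℕ) : SimpleGraph (Fin q) :=
  SimpleGraph.fromRel fun i _ => i.val = 1

/-- The tree `Z_q` (`q ≥ 4`), rooted at its special pendant vertex. It is the path `0 - 1 - 2`
with the `q - 3` further vertices `3, …, q - 1` all joined to `2`: for `q ≥ 5` it has `q - 2`
pendant vertices, one `2`-vertex (namely `1`) and one `(q - 2)`-vertex (namely `2`), and `0` is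
the pendant vertex adjacent to the `2`-vertex; for `q = 4` it is the path `P_4` rooted at an
end vertex. -/
def zTree (q : ℕ) : SimpleGraph (Fin q) :=
  SimpleGraph.fromRel fun i j =>
    (i.val = 0 ∧ j.val = 1) ∨ (i.val = 1 ∧ j.val = 2) ∨ (i.val = 2 ∧ 3 ≤ j.val)

/-- The graph with a triangle `u₁u₂u₃` such that the rooted tree `T i (s i)` hangs at `u_i`;
here `u_i` is the root `0` of the `i`-th tree. -/
def triangleWithTrees (T : Fin 3 → (q : ℕ) → SimpleGraph (Fin q)) (s : Fin 3 → ℕ) :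
    SimpleGraph (Σ i : Fin 3, Fin (s i)) where
  Adj x y :=
    (∃ (i : Fin 3) (a b : Fin (s i)), x = ⟨i, a⟩ ∧ y = ⟨i, b⟩ ∧ (T i (s i)).Adj a b) ∨
    (x.1 ≠ y.1 ∧ x.2.val = 0 ∧ y.2.val = 0)
  symm := by
    constructor
    rintro x y (⟨i, a, b, hx, hy, h⟩ | ⟨h, hx, hy⟩)
    · exact Or.inl ⟨i, b, a, hy, hx, h.symm⟩
    · exact Or.inr ⟨h.symm, hy, hx⟩
  loopless := by
    constructor
    rintro x (⟨i, a, b, hx, hy, h⟩ | ⟨h, -, -⟩)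
    · rw [hx] at hy
      obtain rfl : a = b := by simpa using hy
      exact h.ne rfl
    · exact h rfl

/-- `A_{s₁,s₂,s₃}`: `T_{u_i} = Z_{s_i}` rooted at its special pendant vertex (`s_i ≥ 4`). -/
def graphA (s₁ s₂ s₃ : ℕ) : SimpleGraph (Σ i : Fin 3, Fin (![s₁, s₂, s₃] i)) :=
  triangleWithTrees ![zTree, zTree, zTree] ![s₁, s₂, s₃]

/-- `B_{s₁,s₂,s₃}`: `T_{u₁} = K_{1,s₁-1}` rooted at its center, `T_{u₂} = Z_{s₂}` and
`T_{u₃} = Z_{s₃}` rooted at their special pendant vertices (`s₁ ≥ 2`, `s₂, s₃ ≥ 4`). -/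
def graphB (s₁ s₂ s₃ : ℕ) : SimpleGraph (Σ i : Fin 3, Fin (![s₁, s₂, s₃] i)) :=
  triangleWithTrees ![centerStar, zTree, zTree] ![s₁, s₂, s₃]

/-- `C_{s₁,s₂,s₃}`: `T_{u₁} = K_{1,s₁-1}` rooted at its center, `T_{u₂} = K_{1,s₂-1}` rooted at
a pendant vertex, `T_{u₃} = Z_{s₃}` rooted at its special pendant vertex
(`s₁ ≥ 2`, `s₂ ≥ 3`, `s₃ ≥ 4`). -/
def graphC (s₁ s₂ s₃ : ℕ) : SimpleGraph (Σ i : Fin 3, Fin (![s₁, s₂, s₃] i)) :=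
  triangleWithTrees ![centerStar, leafStar, zTree] ![s₁, s₂, s₃]

/-! A unicyclic graph is the graph of a self-map `φ` without fixed points or 2-cycles whose orbits
all run into one cycle: each edge joins `v` to `φ v` for exactly one `v`. The periodic points form
the cycle, and the vertices split into the trees `hang φ v` at cycle vertices. Deleting one of these
leaves a tree, and any set whose deletion leaves a tree contains one of them. So being a `k`-apex
tree means that the smallest hanging tree has exactly `k` vertices (`isApexTree_iff`), and AZI is to
be minimised under this constraint.

Write w for `edgeWeight`. On arguments at least 2, w is increasing and w(2, b) = 8; for a, b ≥ 3,
w(a, b) + w(3, 3) ≥ w(3, a) + w(3, b). The x pendant edges of a star attached by its centre cost x +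
3 + `tail x`. After subtracting 1 per vertex, AZI becomes n plus one contribution per cycle vertex
(`augmentedZagrebIndex_eq_sum_core`). The last inequality shares each cycle edge between its ends,
so AZI is at least n plus the sum of the charges (`sum_charge_le`), with equality on a triangle
having two vertices of degree 3. Every charge is at least 21.7, which rules out cycles of length
four or more; two triangle vertices of degree at least 4 are excluded numerically
(`exists_triangle_of_lt_threshold`).

What remains is a comparison of single trees of size s ≥ 4. At a root of degree 3 the cheapest tree
is a star attached by a leaf for s = 4, 5, and `Z_s` for s ≥ 6. At a root of degree at least 4 only
a star centred there can compete, and it wins only for s ≤ 6; at most one root has such a degree.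
The charge of `Z_s` is decreasing and strictly convex in s, so two such trees of given total size
are best when balanced. Comparing constants gives the three regimes. The equality cases determine
the hanging trees, hence the graph (`nonempty_iso_triangleWithTrees`). -/

open Function

/-! ### Self-maps of a finite set: the periodic part and the trees hanging at it. -/

namespace ParentMap

variable {V : Type*} [Fintype V]

open Classical in
/-- The periodic points of a self-map of a finite type. -/
noncomputable def core (φ : V → V) : Finset V := Finset.univ.filter (· ∈ periodicPts φ)

open Classical in
/-- The non-periodic preimages of `v`. -/
noncomputable def kids (φ : V → V) (v : V) : Finset V :=
  Finset.univ.filter fun w => w ∉ core φ ∧ φ w = v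

open Classical in
/-- The tree hanging at `v`: the points whose orbit reaches `v` through non-periodic points. -/
noncomputable def hang (φ : V → V) (v : V) : Finset V :=
  Finset.univ.filter fun u => ∃ i, φ^[i] u = v ∧ ∀ j < i, φ^[j] u ∉ core φ

open Classical in
/-- One more than the number of preimages of `v`. -/
noncomputable def deg (φ : V → V) (v : V) : ℕ := 1 + (Finset.univ.filter fun w => φ w = v).card

variable {φ : V → V} {u v w : V}

lemma mem_core : v ∈ core φ ↔ v ∈ periodicPts φ := by simp [core]

lemma mem_kids : w ∈ kids φ v ↔ w ∉ core φ ∧ φ w = v := by simp [kids]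

lemma mem_hang : u ∈ hang φ v ↔ ∃ i, φ^[i] u = v ∧ ∀ j < i, φ^[j] u ∉ core φ := by simp [hang]

lemma map_mem_core (hv : v ∈ core φ) : φ v ∈ core φ := by
  rw [mem_core] at *
  exact (bijOn_periodicPts φ).mapsTo hv

lemma iterate_mem_core (hv : v ∈ core φ) (i : ℕ) : φ^[i] v ∈ core φ := by
  induction i with
  | zero => exact hv
  | succ i ih => rw [iterate_succ_apply']; exact map_mem_core ih

lemma mem_core_of_iterate_eq {i : ℕ} (hi : 0 < i) (h : φ^[i] v = v) : v ∈ core φ :=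
  mem_core.2 ⟨i, hi, h⟩

lemma injOn_core : Set.InjOn φ (core φ) := by
  have : ((core φ : Finset V) : Set V) = periodicPts φ := by ext; simp [mem_core]
  rw [this]
  exact (bijOn_periodicPts φ).injOn

lemma exists_pred_of_mem_core (hv : v ∈ core φ) : ∃ w ∈ core φ, φ w = v := by
  rw [mem_core] at hv
  obtain ⟨w, hw, rfl⟩ := (bijOn_periodicPts φ).surjOn hv
  exact ⟨w, mem_core.2 hw, rfl⟩

lemma exists_iterate_mem_core (φ : V → V) (v : V) : ∃ i, φ^[i] v ∈ core φ := by
  obtain ⟨i, j, hij, h⟩ := Finite.exists_ne_map_eq_of_infinite (fun i : ℕ => φ^[i] v)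
  wlog hlt : i < j generalizing i j
  · exact this j i hij.symm h.symm (by omega)
  refine ⟨i, mem_core_of_iterate_eq (i := j - i) (by omega) ?_⟩
  rw [← iterate_add_apply, Nat.sub_add_cancel hlt.le]
  exact h.symm

lemma self_mem_hang (v : V) : v ∈ hang φ v := mem_hang.2 ⟨0, rfl, by simp⟩

lemma mem_hang_iff_of_mem_core (hv : v ∈ core φ) (hu : u ∈ core φ) :
    u ∈ hang φ v ↔ u = v := by
  refine ⟨fun h => ?_, fun h => by subst h; exact self_mem_hang _⟩
  obtain ⟨i, hi, h⟩ := mem_hang.1 h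
  rcases Nat.eq_zero_or_pos i with rfl | hpos
  · exact hi
  · exact absurd hu (h 0 hpos)

lemma mem_hang_iff : u ∈ hang φ v ↔ u = v ∨ ∃ w ∈ kids φ v, u ∈ hang φ w := by
  constructor
  · rintro h
    obtain ⟨i, hi, h⟩ := mem_hang.1 h
    cases i with
    | zero => exact Or.inl hi
    | succ i =>
      rw [iterate_succ_apply'] at hi
      exact Or.inr ⟨φ^[i] u, mem_kids.2 ⟨h i (by omega), hi⟩,
        mem_hang.2 ⟨i, rfl, fun j hj => h j (by omega)⟩⟩
  · rintro (rfl | ⟨w, hw, h⟩)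
    · exact self_mem_hang u
    · obtain ⟨i, rfl, h'⟩ := mem_hang.1 h
      obtain ⟨hw', rfl⟩ := mem_kids.1 hw
      refine mem_hang.2 ⟨i + 1, iterate_succ_apply' _ _ _, fun j hj => ?_⟩
      rcases Nat.lt_succ_iff_lt_or_eq.1 hj with hj | rfl
      · exact h' j hj
      · exact hw'

lemma notMem_hang_of_mem_kids (hw : w ∈ kids φ v) : v ∉ hang φ w := by
  intro h
  obtain ⟨i, hi, -⟩ := mem_hang.1 h
  obtain ⟨hw', rfl⟩ := mem_kids.1 hw
  exact hw' (mem_core_of_iterate_eq (i := i + 1) (by omega) (by rw [iterate_succ_apply]; exact hi))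

/-- If an orbit met `w` and later `w'`, it would run from `w` to `v`, on to `w'` and back to `v`.
Then `v` would be periodic, and so would `w'`, which lies on the orbit of `v`. -/
lemma disjoint_hang_of_mem_kids {w' : V} (hw : w ∈ kids φ v) (hw' : w' ∈ kids φ v)
    (hne : w ≠ w') : Disjoint (hang φ w) (hang φ w') := by
  rw [Finset.disjoint_left]
  intro u hu hu'
  obtain ⟨i, hi, -⟩ := mem_hang.1 hu
  obtain ⟨j, hj, -⟩ := mem_hang.1 hu'
  wlog hlt : i ≤ j generalizing i j w w'
  · exact this hw' hw hne.symm hu' hu j hj i hi (by omega)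
  obtain ⟨m, rfl⟩ := Nat.exists_eq_add_of_le hlt
  cases m with
  | zero => exact hne (hi ▸ hj)
  | succ m =>
    rw [mem_kids] at hw hw'
    have h1 : φ^[m] v = w' := by
      rw [← hw.2, ← hi, ← hj, ← iterate_succ_apply, ← iterate_add_apply]
      congr 1; omega
    have hv : v ∈ core φ := mem_core_of_iterate_eq (i := m + 1) (by omega)
      (by rw [iterate_succ_apply', h1, hw'.2])
    exact hw'.1 (h1 ▸ iterate_mem_core hv m)

open Classical in
lemma sum_hang (F : V → ℝ) (v : V) :
    ∑ u ∈ hang φ v, F u = F v + ∑ w ∈ kids φ v, ∑ u ∈ hang φ w, F u := by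
  have h : hang φ v = insert v ((kids φ v).biUnion (hang φ)) := by
    ext u; simp [mem_hang_iff (v := v)]
  rw [h, Finset.sum_insert, Finset.sum_biUnion]
  · exact fun w hw w' hw' hne => disjoint_hang_of_mem_kids hw hw' hne
  · simp only [Finset.mem_biUnion, not_exists, not_and]
    exact fun w hw => notMem_hang_of_mem_kids hw

lemma card_hang (v : V) : (hang φ v).card = 1 + ∑ w ∈ kids φ v, (hang φ w).card := by
  have := sum_hang (φ := φ) (fun _ => 1) v
  simp only [Finset.sum_const, nsmul_eq_mul, mul_one] at this
  exact_mod_cast this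

lemma card_hang_pos (v : V) : 0 < (hang φ v).card := Finset.card_pos.2 ⟨v, self_mem_hang v⟩

lemma disjoint_hang_of_mem_core (hv : v ∈ core φ) (hw : w ∈ core φ) (hne : v ≠ w) :
    Disjoint (hang φ v) (hang φ w) := by
  rw [Finset.disjoint_left]
  intro u hu hu'
  obtain ⟨i, hi, h⟩ := mem_hang.1 hu
  obtain ⟨j, hj, h'⟩ := mem_hang.1 hu'
  rcases lt_trichotomy i j with hij | rfl | hij
  · exact h' i hij (hi ▸ hv)
  · exact hne (hi ▸ hj)
  · exact h j hij (hj ▸ hw)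

lemma exists_mem_hang (φ : V → V) (u : V) : ∃ v ∈ core φ, u ∈ hang φ v := by
  classical
  have h := exists_iterate_mem_core φ u
  exact ⟨_, Nat.find_spec h, mem_hang.2 ⟨_, rfl, fun j hj => Nat.find_min h hj⟩⟩

lemma sum_univ (φ : V → V) (F : V → ℝ) : ∑ x, F x = ∑ v ∈ core φ, ∑ u ∈ hang φ v, F u := by
  classical
  have h : (Finset.univ : Finset V) = (core φ).biUnion (hang φ) := by
    ext u; simpa using exists_mem_hang φ u
  rw [h, Finset.sum_biUnion]
  exact fun v hv w hw hne => disjoint_hang_of_mem_core hv hw hne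

lemma sum_card_hang (φ : V → V) : ∑ v ∈ core φ, (hang φ v).card = Fintype.card V := by
  have := sum_univ φ (fun _ => 1)
  simp only [Finset.sum_const, nsmul_eq_mul, mul_one] at this
  exact_mod_cast this.symm

lemma deg_of_notMem_core (hv : v ∉ core φ) : deg φ v = 1 + (kids φ v).card := by
  unfold deg kids
  congr 2
  ext w
  simp only [Finset.mem_filter, Finset.mem_univ, true_and]
  refine ⟨fun h => ⟨fun hw => hv (h ▸ map_mem_core hw), h⟩, fun h => h.2⟩

/-- The extra neighbour, compared with a vertex off the cycle, is the unique predecessor on the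
cycle. -/
lemma deg_of_mem_core (hv : v ∈ core φ) : deg φ v = 2 + (kids φ v).card := by
  classical
  obtain ⟨w, hw, hwv⟩ := exists_pred_of_mem_core hv
  have h : (Finset.univ.filter fun w => φ w = v) = insert w (kids φ v) := by
    ext x
    simp only [Finset.mem_filter, Finset.mem_univ, true_and, Finset.mem_insert, mem_kids]
    constructor
    · intro hx
      by_cases hxc : x ∈ core φ
      · exact Or.inl (injOn_core hxc hw (hx.trans hwv.symm))
      · exact Or.inr ⟨hxc, hx⟩
    · rintro (rfl | h)
      exacts [hwv, h.2]
  have h2 : deg φ v = 1 + (insert w (kids φ v)).card := by rw [← h]; unfold deg; congr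
  rw [h2, Finset.card_insert_of_notMem]
  · omega
  · simp [mem_kids, hw]

lemma sum_core_comp (φ : V → V) (F : V → ℝ) : ∑ v ∈ core φ, F (φ v) = ∑ v ∈ core φ, F v := by
  refine Finset.sum_bij (fun v _ => φ v) (fun v hv => map_mem_core hv)
    (fun v hv w hw h => injOn_core hv hw h) (fun v hv => ?_) (fun _ _ => rfl)
  obtain ⟨w, hw, h⟩ := exists_pred_of_mem_core hv
  exact ⟨w, hw, h⟩

lemma kids_notMem_core (hw : w ∈ kids φ v) : w ∉ core φ := (mem_kids.1 hw).1

lemma map_kids (hw : w ∈ kids φ v) : φ w = v := (mem_kids.1 hw).2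

end ParentMap

/-! ### Unicyclic graphs as graphs of self-maps, and the apex condition. -/

/-- `φ` orients the edges of `G`, every vertex having out-degree one, so that all
orbits of `φ` run into one cycle of length at least three. -/
structure SimpleGraph.IsOrientedBy {V : Type*} (G : SimpleGraph V) (φ : V → V) : Prop where
  adj_iff : ∀ u v, G.Adj u v ↔ φ u = v ∨ φ v = u
  map_map_ne : ∀ v, φ (φ v) ≠ v
  reach : ∃ r, ∀ v, ∃ i, φ^[i] v = r

/-- The weight of an edge whose ends have degrees `a` and `b`. -/
noncomputable def edgeWeight (a b : ℝ) : ℝ := (a * b / (a + b - 2)) ^ 3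

namespace SimpleGraph.IsOrientedBy

open ParentMap

variable {V : Type*} {G : SimpleGraph V} {φ : V → V}

lemma map_ne (h : G.IsOrientedBy φ) (v : V) : φ v ≠ v := fun hv =>
  h.map_map_ne v (by rw [hv, hv])

lemma adj_map (h : G.IsOrientedBy φ) (v : V) : G.Adj v (φ v) := (h.adj_iff _ _).2 (Or.inl rfl)

lemma injective_edge (h : G.IsOrientedBy φ) : Injective fun v => s(v, φ v) := by
  intro u v huv
  simp only [Sym2.eq_iff] at huv
  rcases huv with h1 | ⟨h1, h2⟩
  · exact h1.1
  · exact absurd (by rw [h2, ← h1]) (h.map_map_ne u)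

lemma range_edge (h : G.IsOrientedBy φ) : Set.range (fun v => s(v, φ v)) = G.edgeSet := by
  ext e
  induction e with
  | _ a b =>
    simp only [Set.mem_range, SimpleGraph.mem_edgeSet, h.adj_iff, Sym2.eq_iff]
    constructor
    · rintro ⟨v, ⟨rfl, rfl⟩ | ⟨rfl, rfl⟩⟩ <;> simp
    · rintro (rfl | rfl)
      · exact ⟨a, by simp⟩
      · exact ⟨b, by simp⟩

lemma reachable_iterate (h : G.IsOrientedBy φ) (v : V) (i : ℕ) : G.Reachable v (φ^[i] v) := by
  induction i with
  | zero => exact Reachable.refl _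
  | succ i ih => rw [iterate_succ_apply']; exact ih.trans (h.adj_map _).reachable

lemma connected (h : G.IsOrientedBy φ) : G.Connected := by
  obtain ⟨r, hr⟩ := h.reach
  refine (connected_iff_exists_forall_reachable G).2 ⟨r, fun v => ?_⟩
  obtain ⟨i, rfl⟩ := hr v
  exact (h.reachable_iterate v i).symm

lemma isUnicyclic (h : G.IsOrientedBy φ) : IsUnicyclic G := by
  refine ⟨h.connected, ?_⟩
  rw [← h.range_edge, ← Set.image_univ, Set.ncard_image_of_injective _ h.injective_edge,
    Set.ncard_univ]

variable [Fintype V]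

open Classical in
lemma degree_eq (h : G.IsOrientedBy φ) (v : V) : G.degree v = deg φ v := by
  have hn : G.neighborFinset v = insert (φ v) (Finset.univ.filter fun w => φ w = v) := by
    ext w
    simp [h.adj_iff, eq_comm]
  rw [← card_neighborFinset_eq_degree, hn, Finset.card_insert_of_notMem, deg, add_comm]
  simpa using h.map_map_ne v

lemma augmentedZagrebIndex_eq (h : G.IsOrientedBy φ) :
    augmentedZagrebIndex G = ∑ v, edgeWeight (deg φ v) (deg φ (φ v)) := by
  classical
  unfold augmentedZagrebIndex
  symm
  refine Finset.sum_nbij (fun v => s(v, φ v)) ?_ (fun u _ v _ huv => h.injective_edge huv) ?_ ?_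
  · intro v _
    simpa using h.adj_map v
  · intro e he
    have : e ∈ G.edgeSet := by simpa using he
    rw [← h.range_edge] at this
    obtain ⟨v, rfl⟩ := this
    exact ⟨v, by simp, rfl⟩
  · intro v _
    simp [edgeWeight, h.degree_eq]

lemma exists_iterate_eq_of_mem_core (h : G.IsOrientedBy φ) {u v : V} (hv : v ∈ core φ) :
    ∃ i, φ^[i] u = v := by
  obtain ⟨r, hr⟩ := h.reach
  obtain ⟨i, hi⟩ := hr u
  obtain ⟨j, hj⟩ := hr v
  obtain ⟨m, hm, hp⟩ := mem_core.1 hv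
  -- Since `v` reaches `r` in `j` steps and returns to itself after `j * m`, the point `r` reaches
  -- `v` in the remaining `j * m - j` steps.
  have h2 : φ^[j * m] v = v := hp.const_mul j
  refine ⟨j * m - j + i, ?_⟩
  have hle : j ≤ j * m := Nat.le_mul_of_pos_right j hm
  rw [iterate_add_apply, hi, ← hj, ← iterate_add_apply, Nat.sub_add_cancel hle, h2]

/-- An arrow can enter a hanging tree from outside only at its root, along the cycle. This is what
makes the trees separable from the rest of the graph. -/
lemma map_mem_core_of_map_mem_hang {u v : V} (hv : v ∈ core φ) (hu : φ u ∈ hang φ v)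
    (hun : u ∉ hang φ v) : φ u = v ∧ u ∈ core φ := by
  have huc : u ∈ core φ := by
    by_contra huc
    obtain ⟨i, hi, h⟩ := mem_hang.1 hu
    refine hun (mem_hang.2 ⟨i + 1, by rw [iterate_succ_apply]; exact hi, fun j hj => ?_⟩)
    cases j with
    | zero => exact huc
    | succ j => rw [iterate_succ_apply]; exact h j (by omega)
  exact ⟨(mem_hang_iff_of_mem_core hv (map_mem_core huc)).1 hu, huc⟩

lemma map_mem_hang {u v : V} (hu : u ∈ hang φ v) (hne : u ≠ v) : φ u ∈ hang φ v := by
  obtain ⟨i, hi, h⟩ := mem_hang.1 hu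
  cases i with
  | zero => exact absurd hi hne
  | succ i =>
    refine mem_hang.2 ⟨i, by rw [iterate_succ_apply] at hi; exact hi, fun j hj => ?_⟩
    have := h (j + 1) (by omega)
    rwa [iterate_succ_apply] at this

/-- Deleting the tree that hangs at a vertex of the cycle leaves a tree. -/
lemma isTree_induce_compl_hang (h : G.IsOrientedBy φ) {v : V} (hv : v ∈ core φ) :
    (G.induce {x | x ∉ hang φ v}).IsTree := by
  classical
  set W : Set V := {x | x ∉ hang φ v} with hW
  -- The cycle predecessor `ρ` of `v` serves as root of what survives: it is the only surviving
  -- vertex whose arrow is lost. This gives connectedness and at most `|W| - 1` edges.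
  obtain ⟨ρ, hρ, hρv⟩ := exists_pred_of_mem_core hv
  have hρW : ρ ∈ W := by
    intro hmem
    rw [mem_hang_iff_of_mem_core hv hρ] at hmem
    exact h.map_ne ρ (by rw [hρv, hmem])
  have hstep : ∀ x ∈ W, x ≠ ρ → φ x ∈ W := by
    intro x hx hne hmem
    obtain ⟨h1, h2⟩ := map_mem_core_of_map_mem_hang hv hmem hx
    exact hne (injOn_core h2 hρ (h1.trans hρv.symm))
  have hreach : ∀ i, ∀ x (hx : x ∈ W), φ^[i] x = ρ → (G.induce W).Reachable ⟨ρ, hρW⟩ ⟨x, hx⟩ := by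
    intro i
    induction i with
    | zero => rintro x hx rfl; exact Reachable.refl _
    | succ i ih =>
      intro x hx hi
      by_cases hxρ : x = ρ
      · subst hxρ; exact Reachable.refl _
      · refine (ih (φ x) (hstep x hx hxρ) (by rwa [iterate_succ_apply] at hi)).trans ?_
        exact (show (G.induce W).Adj ⟨φ x, _⟩ ⟨x, hx⟩ from (h.adj_map x).symm).reachable
  have hconn : (G.induce W).Connected := by
    refine (connected_iff_exists_forall_reachable _).2 ⟨⟨ρ, hρW⟩, fun x => ?_⟩
    obtain ⟨i, hi⟩ := h.exists_iterate_eq_of_mem_core (u := x.1) hρ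
    exact hreach i x.1 x.2 hi
  rw [isTree_iff_connected_and_card]
  refine ⟨hconn, le_antisymm ?_ hconn.card_vert_le_card_edgeSet_add_one⟩
  have hsub : ((fun e : Sym2 W => Sym2.map Subtype.val e) '' (G.induce W).edgeSet) ⊆
      (fun x => s(x, φ x)) '' (W \ {ρ}) := by
    rintro _ ⟨e, he, rfl⟩
    induction e with
    | _ a b =>
      have hab : G.Adj a.1 b.1 := he
      have key : ∀ a b : W, φ a.1 = b.1 → s(a.1, b.1) ∈ (fun x => s(x, φ x)) '' (W \ {ρ}) := by
        intro a b hab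
        refine ⟨a.1, ⟨a.2, fun hz => b.2 ?_⟩, by simp [hab]⟩
        rw [← hab, Set.mem_singleton_iff.1 hz, hρv]
        exact self_mem_hang v
      simp only [Sym2.map_mk]
      rcases (h.adj_iff _ _).1 hab with h1 | h1
      · exact key a b h1
      · rw [Sym2.eq_swap]; exact key b a h1
  have hinj : Injective (fun e : Sym2 W => Sym2.map Subtype.val e) :=
    Sym2.map.injective Subtype.val_injective
  have h1 : Nat.card (G.induce W).edgeSet =
      ((fun e : Sym2 W => Sym2.map Subtype.val e) '' (G.induce W).edgeSet).ncard := by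
    rw [Set.ncard_image_of_injective _ hinj, Nat.card_coe_set_eq]
  have h2 := Set.ncard_le_ncard hsub (Set.toFinite _)
  have h3 : ((fun x => s(x, φ x)) '' (W \ {ρ})).ncard ≤ (W \ {ρ}).ncard :=
    Set.ncard_image_le (Set.toFinite _)
  have h4 : (W \ {ρ}).ncard + 1 = W.ncard := Set.ncard_sdiff_singleton_add_one hρW (Set.toFinite _)
  rw [h1, Nat.card_coe_set_eq]
  omega

/-- The periodic points induce a connected graph with an edge `x`, `φ x` for each of its vertices,
too many for a tree. -/
lemma not_isAcyclic_induce_core (h : G.IsOrientedBy φ) {W : Set V}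
    (hW : ∀ v ∈ core φ, v ∈ W) : ¬ (G.induce W).IsAcyclic := by
  classical
  intro hac
  set C : Set V := {x | x ∈ core φ} with hC
  have hacC : (G.induce C).IsAcyclic :=
    hac.embedding (SimpleGraph.induceHomOfLE G (fun v hv => hW v hv))
  obtain ⟨r, hr⟩ : ∃ r, r ∈ C := by
    obtain ⟨r, -⟩ := h.reach
    exact ⟨_, (exists_iterate_mem_core φ r).choose_spec⟩
  have hreach : ∀ i, ∀ x (hx : x ∈ C), (G.induce C).Reachable ⟨x, hx⟩
      ⟨φ^[i] x, iterate_mem_core hx i⟩ := by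
    intro i x hx
    induction i with
    | zero => exact Reachable.refl _
    | succ i ih =>
      refine ih.trans (Adj.reachable ?_)
      show G.Adj (φ^[i] x) (φ^[i + 1] x)
      rw [iterate_succ_apply']
      exact h.adj_map _
  have hconn : (G.induce C).Connected := by
    refine (connected_iff_exists_forall_reachable _).2 ⟨⟨r, hr⟩, fun x => ?_⟩
    obtain ⟨i, hi⟩ := h.exists_iterate_eq_of_mem_core (u := x.1) hr
    have := hreach i x.1 x.2
    simp only [hi] at this
    exact this.symm
  have hcard := (isTree_iff_connected_and_card.1 ⟨hconn, hacC⟩).2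
  have hle : Nat.card C ≤ Nat.card (G.induce C).edgeSet := by
    refine Nat.card_le_card_of_injective
      (fun x : C => (⟨s(x, ⟨φ x, map_mem_core x.2⟩), h.adj_map x.1⟩ : (G.induce C).edgeSet)) ?_
    intro x y hxy
    have h2 : s(x, (⟨φ x, map_mem_core x.2⟩ : C)) = s(y, ⟨φ y, map_mem_core y.2⟩) :=
      congrArg Subtype.val hxy
    have h3 := congrArg (Sym2.map Subtype.val) h2
    simp only [Sym2.map_mk] at h3
    exact Subtype.ext (h.injective_edge h3)
  omega

/-- A vertex set whose deletion leaves a tree contains a tree hanging at a cycle vertex. -/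
lemma exists_hang_subset (h : G.IsOrientedBy φ) {X : Finset V}
    (hX : (G.induce {v | v ∉ X}).IsTree) : ∃ v ∈ core φ, hang φ v ⊆ X := by
  obtain ⟨v, hv, hvX⟩ : ∃ v ∈ core φ, v ∈ X := by
    by_contra! hcon
    exact h.not_isAcyclic_induce_core (W := {v | v ∉ X}) hcon hX.isAcyclic
  -- If some vertex of the tree at `v` survives, then, `v` being deleted, connectedness confines all
  -- survivors to that tree. The tree at the next cycle vertex `φ v` is then entirely deleted.
  by_cases hsub : hang φ v ⊆ X
  · exact ⟨v, hv, hsub⟩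
  obtain ⟨x, hx, hxX⟩ := Finset.not_subset.1 hsub
  have hall : ∀ y : {v | v ∉ X}, y.1 ∈ hang φ v := by
    intro y
    obtain ⟨p⟩ := hX.connected.preconnected ⟨x, hxX⟩ y
    have key : ∀ (a b : {v | v ∉ X}) (p : (G.induce {v | v ∉ X}).Walk a b),
        a.1 ∈ hang φ v → b.1 ∈ hang φ v := by
      intro a b p
      induction p with
      | nil => exact id
      | @cons a b c hab _ ih =>
        intro ha
        apply ih
        have hadj : G.Adj a.1 b.1 := hab
        rcases (h.adj_iff _ _).1 hadj with h1 | h1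
        · rw [← h1]
          exact map_mem_hang ha (fun hav => a.2 (hav ▸ hvX))
        · by_contra hb
          have h2 := map_mem_core_of_map_mem_hang hv (u := b.1) (h1 ▸ ha) hb
          exact a.2 (by rw [← h1, h2.1]; exact hvX)
    exact key _ _ p hx
  refine ⟨φ v, map_mem_core hv, fun y hy => ?_⟩
  by_contra hyX
  exact Finset.disjoint_left.1
    (disjoint_hang_of_mem_core hv (map_mem_core hv) (h.map_ne v).symm) (hall ⟨y, hyX⟩) hy

/-- The sets whose deletion leaves a tree include all hanging trees, and each of them contains one;
so the least size of such a set is that of the smallest hanging tree. -/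
lemma isApexTree_iff (h : G.IsOrientedBy φ) (k : ℕ) :
    IsApexTree k G ↔ (∀ v ∈ core φ, k ≤ (hang φ v).card) ∧ ∃ v ∈ core φ, (hang φ v).card = k := by
  constructor
  · rintro ⟨-, ⟨X, hXk, hX⟩, hmin⟩
    have hge : ∀ v ∈ core φ, k ≤ (hang φ v).card := fun v hv => by
      by_contra! hlt
      exact hmin _ hlt (h.isTree_induce_compl_hang hv)
    obtain ⟨v, hv, hsub⟩ := h.exists_hang_subset hX
    exact ⟨hge, v, hv, le_antisymm (hXk ▸ Finset.card_le_card hsub) (hge v hv)⟩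
  · rintro ⟨hge, v, hv, hk⟩
    refine ⟨h.connected, ⟨_, hk, h.isTree_induce_compl_hang hv⟩, fun X hXk hX => ?_⟩
    obtain ⟨w, hw, hsub⟩ := h.exists_hang_subset hX
    have := Finset.card_le_card hsub
    have := hge w hw
    omega

lemma three_le_card_core (h : G.IsOrientedBy φ) : 3 ≤ (core φ).card := by
  classical
  obtain ⟨r, -⟩ := h.reach
  obtain ⟨i, hi⟩ := exists_iterate_mem_core φ r
  set v := φ^[i] r
  have hsub : ({v, φ v, φ (φ v)} : Finset V) ⊆ core φ := by
    intro x hx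
    simp only [Finset.mem_insert, Finset.mem_singleton] at hx
    rcases hx with rfl | rfl | rfl
    exacts [hi, map_mem_core hi, map_mem_core (map_mem_core hi)]
  have h3 : ({v, φ v, φ (φ v)} : Finset V).card = 3 :=
    Finset.card_eq_three.2 ⟨_, _, _, (h.map_ne v).symm, (h.map_map_ne v).symm,
      (h.map_ne (φ v)).symm, rfl⟩
  exact h3 ▸ Finset.card_le_card hsub

end SimpleGraph.IsOrientedBy

/-- Every unicyclic graph can be oriented with all out-degrees one. -/
lemma IsUnicyclic.exists_isOrientedBy {V : Type*} [Finite V] {G : SimpleGraph V}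
    (hG : IsUnicyclic G) : ∃ φ, G.IsOrientedBy φ := by
  classical
  obtain ⟨hconn, hcard⟩ := hG
  obtain ⟨T, hTG, hT⟩ := hconn.exists_isTree_le
  have hTc := (SimpleGraph.isTree_iff_connected_and_card.1 hT).2
  rw [Nat.card_coe_set_eq] at hTc
  have hsub : T.edgeSet ⊆ G.edgeSet := SimpleGraph.edgeSet_subset_edgeSet.2 hTG
  have hdiff : (G.edgeSet \ T.edgeSet).ncard = 1 := by
    rw [Set.ncard_sdiff hsub (Set.toFinite _)]; omega
  obtain ⟨e, he⟩ := Set.ncard_eq_one.1 hdiff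
  induction e with
  | _ x y =>
    have hxy : s(x, y) ∈ G.edgeSet \ T.edgeSet := he ▸ rfl
    have hGxy : G.Adj x y := hxy.1
    have hTxy : ¬ T.Adj x y := hxy.2
    have hadj : ∀ a b, G.Adj a b ↔ T.Adj a b ∨ s(a, b) = s(x, y) := by
      intro a b
      constructor
      · intro hab
        by_cases hT' : T.Adj a b
        · exact Or.inl hT'
        · exact Or.inr (by
            have : s(a, b) ∈ G.edgeSet \ T.edgeSet := ⟨hab, hT'⟩
            rw [he] at this
            exact this)
      · rintro (h | h)
        · exact hTG h
        · rw [← SimpleGraph.mem_edgeSet, h]; exact hGxy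
    have hpar : ∀ v, v ≠ x → ∃ w, T.Adj v w ∧ T.dist x v = T.dist x w + 1 := by
      intro v hv
      obtain ⟨p, hp⟩ := hT.connected.exists_walk_length_eq_dist v x
      cases p with
      | nil => exact absurd rfl hv
      | @cons _ w _ hvw p =>
        refine ⟨w, hvw, ?_⟩
        have h1 : T.dist w x ≤ p.length := SimpleGraph.dist_le p
        have h2 : T.dist x v ≤ T.dist x w + T.dist w v := hT.connected.dist_triangle
        rw [SimpleGraph.dist_eq_one_iff_adj.2 hvw.symm] at h2
        simp only [SimpleGraph.Walk.length_cons] at hp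
        rw [T.dist_comm (u := x) (v := v), T.dist_comm (u := x) (v := w)] at *
        omega
    choose! p hpadj hpdist using hpar
    -- Root the spanning tree at `x` and send every other vertex to its parent; the one edge outside
    -- the tree supplies the arrow from `x` to `y` and closes the cycle.
    set φ : V → V := fun v => if v = x then y else p v with hφ
    have hφx : φ x = y := by simp [hφ]
    have hφp : ∀ v, v ≠ x → φ v = p v := fun v hv => by simp [hφ, hv]
    -- The parent edges are distinct and number one less than the vertices, so they exhaust the
    -- spanning tree.
    have hsurj : (fun v => s(v, p v)) '' {v | v ≠ x} = T.edgeSet := by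
      apply Set.eq_of_subset_of_ncard_le
      · rintro _ ⟨v, hv, rfl⟩
        exact hpadj v hv
      · rw [Set.InjOn.ncard_image]
        · have : ({v | v ≠ x} : Set V) = {x}ᶜ := by ext; simp
          rw [this]
          have := Set.ncard_add_ncard_compl ({x} : Set V)
          rw [Set.ncard_singleton] at this
          omega
        · intro u hu v hv huv
          simp only [Sym2.eq_iff] at huv
          rcases huv with h1 | ⟨h1, h2⟩
          · exact h1.1
          · have := hpdist u hu
            have := hpdist v hv
            rw [← h1, h2] at *
            omega
      · exact Set.toFinite _
    have hyx : y ≠ x := hGxy.ne'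
    refine ⟨φ, ⟨fun a b => ?_, fun v hv => ?_, x, fun v => ?_⟩⟩
    · rw [hadj]
      constructor
      · rintro (h | h)
        · have : s(a, b) ∈ T.edgeSet := h
          rw [← hsurj] at this
          obtain ⟨v, hv, hvab⟩ := this
          simp only [Sym2.eq_iff] at hvab
          rcases hvab with ⟨rfl, rfl⟩ | ⟨rfl, rfl⟩
          · exact Or.inl (hφp _ hv)
          · exact Or.inr (hφp _ hv)
        · rw [Sym2.eq_iff] at h
          rcases h with ⟨rfl, rfl⟩ | ⟨rfl, rfl⟩
          · exact Or.inl hφx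
          · exact Or.inr hφx
      · have key : ∀ a, T.Adj a (φ a) ∨ s(a, φ a) = s(x, y) := by
          intro a
          by_cases ha : a = x
          · subst ha; rw [hφx]; exact Or.inr rfl
          · rw [hφp a ha]; exact Or.inl (hpadj a ha)
        rintro (rfl | rfl)
        · exact key a
        · rcases key b with h | h
          · exact Or.inl h.symm
          · exact Or.inr (by rw [Sym2.eq_swap]; exact h)
    · by_cases hvx : v = x
      · subst hvx
        rw [hφx, hφp y hyx] at hv
        exact hTxy (hv ▸ (hpadj y hyx)).symm
      · rw [hφp v hvx] at hv
        by_cases hpx : p v = x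
        · rw [hpx, hφx] at hv
          exact hTxy (hv ▸ hpx ▸ (hpadj v hvx)).symm
        · rw [hφp _ hpx] at hv
          have h1 := hpdist v hvx
          have h2 := hpdist _ hpx
          rw [hv] at h2
          omega
    · have key : ∀ m v, T.dist x v = m → φ^[m] v = x := by
        intro m
        induction m with
        | zero => intro v hv; exact ((hT.connected.dist_eq_zero_iff).1 hv).symm
        | succ m ih =>
          intro v hv
          have hvx : v ≠ x := by rintro rfl; simp at hv
          rw [Function.iterate_succ_apply, hφp v hvx]
          exact ih _ (by have := hpdist v hvx; omega)
      exact ⟨_, key _ v rfl⟩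

/-! ### Inequalities for the edge weight. -/

lemma edgeWeight_comm (a b : ℝ) : edgeWeight a b = edgeWeight b a := by
  unfold edgeWeight; rw [mul_comm, add_comm]

/-- Independence of `b` is the reason `Z_s` is good: a vertex of degree 2 shields the centre of a
large star from the cycle at a fixed price. -/
lemma edgeWeight_two {b : ℝ} (hb : 2 ≤ b) : edgeWeight 2 b = 8 := by
  unfold edgeWeight
  have : 2 * b / (2 + b - 2) = 2 := by
    rw [div_eq_iff (by linarith)]; ring
  rw [this]; norm_num

lemma edgeWeight_mono_left {a a' b : ℝ} (ha : 2 ≤ a) (h : a ≤ a') (hb : 2 ≤ b) :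
    edgeWeight a b ≤ edgeWeight a' b := by
  unfold edgeWeight
  have h1 : 0 < a + b - 2 := by linarith
  have h2 : 0 < a' + b - 2 := by linarith
  refine pow_le_pow_left₀ (by positivity) ?_ 3
  rw [div_le_div_iff₀ h1 h2]
  nlinarith [mul_nonneg (sub_nonneg.2 h) (mul_nonneg (by linarith : (0:ℝ) ≤ b) (sub_nonneg.2 hb))]

lemma edgeWeight_mono {a a' b b' : ℝ} (ha : 2 ≤ a) (h : a ≤ a') (hb : 2 ≤ b) (h' : b ≤ b') :
    edgeWeight a b ≤ edgeWeight a' b' := by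
  refine (edgeWeight_mono_left ha h hb).trans ?_
  rw [edgeWeight_comm a' b, edgeWeight_comm a' b']
  exact edgeWeight_mono_left hb h' (ha.trans h)

lemma eight_le_edgeWeight {a b : ℝ} (ha : 2 ≤ a) (hb : 2 ≤ b) : 8 ≤ edgeWeight a b := by
  rw [← edgeWeight_two hb]
  exact edgeWeight_mono_left le_rfl ha hb

/-- Supermodularity of the edge weight. -/
lemma edgeWeight_add_le {a b : ℝ} (ha : 3 ≤ a) (hb : 3 ≤ b) :
    edgeWeight 3 a + edgeWeight 3 b ≤ edgeWeight a b + edgeWeight 3 3 := by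
  rw [edgeWeight_comm 3 a]
  unfold edgeWeight
  set X := a * b / (a + b - 2) with hX
  set Y := 3 * b / (3 + b - 2) with hY
  set P := a * 3 / (a + 3 - 2) with hP
  set Q : ℝ := 3 * 3 / (3 + 3 - 2) with hQ
  have hXY : X - Y = b * (b - 2) * (a - 3) / ((a + b - 2) * (b + 1)) := by
    rw [hX, hY, div_sub_div _ _ (by linarith) (by linarith),
      div_eq_div_iff (by nlinarith) (by nlinarith)]
    ring
  have hPQ : P - Q = 3 * (a - 3) / (4 * (a + 1)) := by
    rw [hP, hQ, div_sub_div _ _ (by linarith) (by norm_num), div_eq_div_iff (by nlinarith) (by nlinarith)]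
    ring
  have hPQ0 : 0 ≤ P - Q := by
    rw [hPQ]; exact div_nonneg (by linarith) (by linarith)
  -- It suffices to work before cubing: the increment in the first argument is larger at `b` than at
  -- 3, and it starts from the larger base `Y ≥ Q`.
  have hle : P - Q ≤ X - Y := by
    rw [hPQ, hXY, div_le_div_iff₀ (by linarith) (by nlinarith)]
    have h0 : 3 * ((a + b - 2) * (b + 1)) ≤ b * (b - 2) * (4 * (a + 1)) := by
      nlinarith [mul_nonneg (sub_nonneg.2 ha) (sub_nonneg.2 hb),
        mul_nonneg (sub_nonneg.2 hb) (sub_nonneg.2 hb),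
        mul_nonneg (mul_nonneg (sub_nonneg.2 ha) (sub_nonneg.2 hb)) (sub_nonneg.2 hb)]
    nlinarith [mul_le_mul_of_nonneg_left h0 (sub_nonneg.2 ha)]
  have hQY : Q ≤ Y := by
    rw [hQ, hY, div_le_div_iff₀ (by norm_num) (by linarith)]
    linarith
  have hQ0 : 0 ≤ Q := by rw [hQ]; norm_num
  have hX' : X = Y + (X - Y) := by ring
  have hP' : P = Q + (P - Q) := by ring
  set e := X - Y
  set e' := P - Q
  rw [hX', hP']
  -- The three terms of (Y + e)³ - Y³ = 3Y²e + 3Ye² + e³ are compared separately.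
  have h1 : Q ^ 2 * e' ≤ Y ^ 2 * e := by gcongr
  have h2 : Q * e' ^ 2 ≤ Y * e ^ 2 := by gcongr
  have h3 : e' ^ 3 ≤ e ^ 3 := by gcongr
  nlinarith

/-- The amount `x ((x + 1) / x) ^ 3 - x - 3`. -/
noncomputable def tail (x : ℝ) : ℝ := 3 / x + 1 / x ^ 2

lemma tail_pos {x : ℝ} (hx : 0 < x) : 0 < tail x := by unfold tail; positivity

lemma tail_anti {x y : ℝ} (hx : 0 < x) (h : x ≤ y) : tail y ≤ tail x := by
  unfold tail; gcongr

/-! ### Lower bounds for branches off the cycle. -/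

namespace ParentMap

variable {V : Type*} [Fintype V] {φ : V → V} {u v w c : V}

/-- The total weight of the edges `u, φ u` with `u` in the tree hanging at `v`,
minus the number of vertices of that tree. -/
noncomputable def excess (φ : V → V) (v : V) : ℝ :=
  ∑ u ∈ hang φ v, (edgeWeight (deg φ u) (deg φ (φ u)) - 1)

lemma excess_eq (φ : V → V) (v : V) : excess φ v =
    edgeWeight (deg φ v) (deg φ (φ v)) - 1 + ∑ w ∈ kids φ v, excess φ w :=
  sum_hang _ v

/-- `w` has children, all of which are childless. -/
def IsStar (φ : V → V) (w : V) : Prop := (kids φ w).Nonempty ∧ ∀ c ∈ kids φ w, kids φ c = ∅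

lemma two_le_deg_of_mem_kids (hc : c ∈ kids φ v) : 2 ≤ deg φ v := by
  have hpos : 0 < (kids φ v).card := Finset.card_pos.2 ⟨c, hc⟩
  by_cases hv : v ∈ core φ
  · rw [deg_of_mem_core hv]; omega
  · rw [deg_of_notMem_core hv]; omega

lemma two_le_deg_map (hw : w ∉ core φ) : 2 ≤ deg φ (φ w) :=
  two_le_deg_of_mem_kids (mem_kids.2 ⟨hw, rfl⟩)

lemma card_hang_of_kids_eq_empty (h : kids φ w = ∅) : (hang φ w).card = 1 := by
  rw [card_hang, h]; simp

lemma excess_of_kids_eq_empty (hw : w ∉ core φ) (h : kids φ w = ∅) :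
    excess φ w = ((deg φ (φ w) : ℝ) / (deg φ (φ w) - 1)) ^ 3 - 1 := by
  rw [excess_eq, h, deg_of_notMem_core hw, h]
  simp only [Finset.card_empty, Finset.sum_empty, edgeWeight]
  have e : (((1 + 0 : ℕ) : ℝ) + (deg φ (φ w) : ℝ) - 2) = deg φ (φ w) - 1 := by push_cast; ring
  rw [e]
  push_cast
  ring

lemma card_hang_of_forall_kids (h : ∀ c ∈ kids φ w, kids φ c = ∅) :
    (hang φ w).card = 1 + (kids φ w).card := by
  rw [card_hang, Finset.sum_congr rfl fun c hc => card_hang_of_kids_eq_empty (h c hc)]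
  simp

lemma sum_excess_kids (h : ∀ c ∈ kids φ w, kids φ c = ∅) :
    ∑ c ∈ kids φ w, excess φ c =
      (kids φ w).card * (((deg φ w : ℝ) / (deg φ w - 1)) ^ 3 - 1) := by
  rw [Finset.sum_congr rfl fun c hc => by
    rw [excess_of_kids_eq_empty (kids_notMem_core hc) (h c hc), map_kids hc]]
  rw [Finset.sum_const, nsmul_eq_mul]

/-- With x leaves, the pendant edges weigh x(1 + 1/x)³ = x + 3 + `tail x`. Subtracting 1 for each of
the x + 1 vertices leaves the constant 2. -/
lemma excess_of_isStar (hw : w ∉ core φ) (h : IsStar φ w) :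
    excess φ w = edgeWeight (hang φ w).card (deg φ (φ w)) + 2 + tail ((hang φ w).card - 1) := by
  have hpos : 0 < (kids φ w).card := Finset.card_pos.2 h.1
  rw [excess_eq, sum_excess_kids h.2, card_hang_of_forall_kids h.2, deg_of_notMem_core hw]
  have h0 : (0 : ℝ) < (kids φ w).card := by exact_mod_cast hpos
  push_cast
  set x : ℝ := ((kids φ w).card : ℝ)
  have : x * (((1 + x) / (1 + x - 1)) ^ 3 - 1) = 3 + tail (1 + x - 1) := by
    unfold tail
    rw [add_sub_cancel_left]
    field_simp
    ring
  rw [this]; ring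

lemma IsStar.two_le_card (h : IsStar φ w) : 2 ≤ (hang φ w).card := by
  have hpos : 0 < (kids φ w).card := Finset.card_pos.2 h.1
  rw [card_hang_of_forall_kids h.2]; omega

lemma card_hang_lt_of_mem_kids (hc : c ∈ kids φ w) : (hang φ c).card + 1 ≤ (hang φ w).card := by
  rw [card_hang w, add_comm]
  exact Nat.add_le_add_left
    (Finset.single_le_sum (f := fun c => (hang φ c).card) (fun _ _ => Nat.zero_le _) hc) 1

lemma two_le_deg_of_nonempty_kids (hw : (kids φ w).Nonempty) : 2 ≤ deg φ w :=
  two_le_deg_of_mem_kids hw.choose_spec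

/-- Lower bounds for the excess of a branch. -/
lemma excess_bounds (m : ℕ) : ∀ w ∉ core φ, (hang φ w).card = m →
    0 ≤ excess φ w ∧ ((kids φ w).Nonempty → 2 ≤ m ∧ 10 + tail (m - 1) ≤ excess φ w ∧
      (IsStar φ w ∨ (3 ≤ m ∧ 17 + tail (m - 2) ≤ excess φ w))) := by
  induction m using Nat.strong_induction_on with
  | _ m ih =>
    intro w hw hm
    have hp : (2 : ℝ) ≤ deg φ (φ w) := by exact_mod_cast two_le_deg_map hw
    by_cases hne : (kids φ w).Nonempty
    · have hd : (2 : ℝ) ≤ deg φ w := by exact_mod_cast two_le_deg_of_nonempty_kids hne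
      by_cases hstar : IsStar φ w
      · have h2 := hstar.two_le_card
        have hx := excess_of_isStar hw hstar
        rw [hm] at h2 hx
        have h2' : (2 : ℝ) ≤ m := by exact_mod_cast h2
        have h8 := eight_le_edgeWeight h2' hp
        have := tail_pos (x := m - 1) (by linarith)
        exact ⟨by linarith, fun _ => ⟨h2, by linarith, Or.inl hstar⟩⟩
      · obtain ⟨c, hc, hcne⟩ : ∃ c ∈ kids φ w, (kids φ c).Nonempty := by
          by_contra! hcon
          exact hstar ⟨hne, hcon⟩
        have hlt := card_hang_lt_of_mem_kids hc
        -- The child contributes 10 and a tail, and the edge above `w` contributes at least 8 - 1;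
        -- hence 17.
        obtain ⟨hc2, hcb, -⟩ := (ih _ (by omega) c (kids_notMem_core hc) rfl).2 hcne
        have hsum : excess φ c ≤ ∑ c ∈ kids φ w, excess φ c :=
          Finset.single_le_sum (f := fun c => excess φ c) (fun b hb =>
            (ih _ (by have := card_hang_lt_of_mem_kids hb; omega) b (kids_notMem_core hb) rfl).1) hc
        have h8 := eight_le_edgeWeight hd hp
        have heq := excess_eq φ w
        have hc2' : (2 : ℝ) ≤ (hang φ c).card := by exact_mod_cast hc2
        have hlt' : ((hang φ c).card : ℝ) + 1 ≤ m := by rw [← hm]; exact_mod_cast hlt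
        have ht := tail_anti (x := (hang φ c).card - 1) (y := m - 2) (by linarith) (by linarith)
        have ht' := tail_anti (x := m - 2) (y := m - 1) (by linarith) (by linarith)
        have := tail_pos (x := m - 1) (by linarith)
        exact ⟨by linarith, fun _ => ⟨by omega, by linarith, Or.inr ⟨by omega, by linarith⟩⟩⟩
    · refine ⟨?_, fun h => absurd h hne⟩
      rw [excess_of_kids_eq_empty hw (Finset.not_nonempty_iff_eq_empty.1 hne)]
      have h1 : (1 : ℝ) ≤ (deg φ (φ w) : ℝ) / (deg φ (φ w) - 1) := by
        rw [le_div_iff₀ (by linarith)]; linarith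
      have := one_le_pow₀ h1 (n := 3)
      linarith

lemma excess_nonneg (hw : w ∉ core φ) : 0 ≤ excess φ w := (excess_bounds _ w hw rfl).1

lemma edgeWeight_three_three : edgeWeight 3 3 = 729 / 64 := by unfold edgeWeight; norm_num

lemma edgeWeight_three_four : edgeWeight 3 4 = 1728 / 125 := by unfold edgeWeight; norm_num

/-- The extreme case is a star with one leaf, where the value is 8 + 2 + `tail 1` = 14. -/
lemma fourteen_le_excess (hw : w ∉ core φ) (hne : (kids φ w).Nonempty) (hp : 3 ≤ deg φ (φ w)) :
    14 ≤ excess φ w := by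
  have hp' : (3 : ℝ) ≤ deg φ (φ w) := by exact_mod_cast hp
  obtain ⟨h2, -, hstar | ⟨h3, hx⟩⟩ := (excess_bounds _ w hw rfl).2 hne
  · rw [excess_of_isStar hw hstar]
    have h2' : (2 : ℝ) ≤ (hang φ w).card := by exact_mod_cast h2
    have ht := tail_pos (x := (hang φ w).card - 1) (by linarith)
    rcases (by omega : (hang φ w).card = 2 ∨ (hang φ w).card = 3 ∨ 4 ≤ (hang φ w).card) with
      h | h | h
    · rw [h, Nat.cast_two, edgeWeight_two (by linarith)]
      norm_num [tail]
    · rw [h]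
      have := edgeWeight_mono (a := 3) (a' := 3) (b := 3) (by norm_num) le_rfl (by norm_num) hp'
      rw [edgeWeight_three_three] at this
      norm_num [tail] at this ⊢
      linarith
    · have h4 : (4 : ℝ) ≤ (hang φ w).card := by exact_mod_cast h
      have := edgeWeight_mono (a := 4) (b := 3) (by norm_num) h4 (by norm_num) hp'
      rw [edgeWeight_comm 4 3, edgeWeight_three_four] at this
      linarith
  · have h3' : (3 : ℝ) ≤ (hang φ w).card := by exact_mod_cast h3
    have ht := tail_pos (x := (hang φ w).card - 2) (by linarith)
    linarith

/-- A branch at a vertex of degree three: a star, a star hanging on an edge, or more costly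
than the latter. -/
lemma excess_trichotomy (hw : w ∉ core φ) (hne : (kids φ w).Nonempty) (hp : deg φ (φ w) = 3) :
    (IsStar φ w ∧
      excess φ w = edgeWeight (hang φ w).card 3 + 2 + tail ((hang φ w).card - 1)) ∨
    ((∃ c, kids φ w = {c} ∧ IsStar φ c) ∧ excess φ w = 17 + tail ((hang φ w).card - 2)) ∨
    17 + tail ((hang φ w).card - 2) < excess φ w := by
  by_cases hstar : IsStar φ w
  · exact Or.inl ⟨hstar, by rw [excess_of_isStar hw hstar, hp]; norm_cast⟩
  right
  obtain ⟨c, hc, hcne⟩ : ∃ c ∈ kids φ w, (kids φ c).Nonempty := by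
    by_contra! hcon
    exact hstar ⟨hne, hcon⟩
  have hlt := card_hang_lt_of_mem_kids hc
  have hcc := kids_notMem_core hc
  obtain ⟨hc2, hcb, hcs⟩ := (excess_bounds _ c hcc rfl).2 hcne
  have hc2' : (2 : ℝ) ≤ (hang φ c).card := by exact_mod_cast hc2
  have heq := excess_eq φ w
  have hlt' : ((hang φ c).card : ℝ) + 1 ≤ (hang φ w).card := by exact_mod_cast hlt
  have ht := tail_anti (x := (hang φ c).card - 1) (y := (hang φ w).card - 2)
    (by linarith) (by linarith)
  by_cases hcard : (kids φ w).card = 1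
  · obtain ⟨c', hkc⟩ := Finset.card_eq_one.1 hcard
    have hcc' : c = c' := by simpa [hkc] using hc
    subst hcc'
    have hd : deg φ w = 2 := by rw [deg_of_notMem_core hw, hcard]
    have hcw : φ c = w := map_kids hc
    have hs : (hang φ w).card = (hang φ c).card + 1 := by
      rw [card_hang w, hkc, Finset.sum_singleton, add_comm]
    rw [hkc, Finset.sum_singleton, hd, hp, Nat.cast_two,
      edgeWeight_two (by norm_num)] at heq
    rcases hcs with hcs | ⟨h3, hcs⟩
    · left
      refine ⟨⟨c, hkc, hcs⟩, ?_⟩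
      rw [heq, excess_of_isStar hcc hcs, hcw, hd, Nat.cast_two, edgeWeight_comm,
        edgeWeight_two hc2', hs]
      push_cast
      ring_nf
    · right
      -- A child that is not a star brings the total above 7 + 17 = 24, while the target is at most
      -- 17 + `tail 1` = 21.
      have := tail_pos (x := (hang φ c).card - 2)
        (by have : (3 : ℝ) ≤ (hang φ c).card := by exact_mod_cast h3
            linarith)
      have h1 : tail ((hang φ w).card - 2) ≤ tail 1 :=
        tail_anti (by norm_num) (by linarith)
      have h2 : tail 1 = 4 := by norm_num [tail]
      linarith
  · right
    -- With two or more children the edge above `w` joins degrees at least 3, so 729/64 - 1 + 10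
    -- already exceeds 17.
    have hpos : 0 < (kids φ w).card := Finset.card_pos.2 hne
    have hd : 3 ≤ deg φ w := by rw [deg_of_notMem_core hw]; omega
    have hd' : (3 : ℝ) ≤ deg φ w := by exact_mod_cast hd
    have h3 : edgeWeight 3 3 ≤ edgeWeight (deg φ w) (deg φ (φ w)) := by
      rw [hp]
      exact edgeWeight_mono (by norm_num) hd' (by norm_num) (by norm_num)
    rw [edgeWeight_three_three] at h3
    have hsum : excess φ c ≤ ∑ c ∈ kids φ w, excess φ c :=
      Finset.single_le_sum (f := fun c => excess φ c) (fun b hb =>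
        excess_nonneg (kids_notMem_core hb)) hc
    linarith

/-- The excess of the tree hanging at a cycle vertex, without the cycle edge. -/
noncomputable def coreExcess (φ : V → V) (v : V) : ℝ := ∑ w ∈ kids φ v, excess φ w - 1

/-- The cycle vertex `v` is a pendant vertex of a star hanging at it. -/
def IsLeafStarAt (φ : V → V) (v : V) : Prop := ∃ w, kids φ v = {w} ∧ IsStar φ w

/-- The tree hanging at `v` is a path of length two ending in the centre of a star. -/
def IsZTreeAt (φ : V → V) (v : V) : Prop := ∃ w c, kids φ v = {w} ∧ kids φ w = {c} ∧ IsStar φ c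

/-- The tree hanging at `v` is a star with centre `v`. -/
def IsCenterStarAt (φ : V → V) (v : V) : Prop := ∀ c ∈ kids φ v, kids φ c = ∅

/-- This is the expansion of (s - 1)((s + 1)/s)³ - s. It stays below 2; the price of a centred star
is its degree s + 1 on the cycle edges. -/
lemma coreExcess_of_isCenterStarAt (hv : v ∈ core φ) (h : IsCenterStarAt φ v) :
    coreExcess φ v = 2 - 2 / ((hang φ v).card : ℝ) ^ 2 - 1 / ((hang φ v).card : ℝ) ^ 3 ∧
      deg φ v = (hang φ v).card + 1 := by
  have hc : deg φ v = (hang φ v).card + 1 := by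
    rw [deg_of_mem_core hv, card_hang_of_forall_kids h]; omega
  refine ⟨?_, hc⟩
  rw [coreExcess, sum_excess_kids h, hc]
  have hk : ((kids φ v).card : ℝ) = (hang φ v).card - 1 := by
    rw [card_hang_of_forall_kids h]; push_cast; ring
  rw [hk]
  have hpos : (0 : ℝ) < (hang φ v).card := by exact_mod_cast card_hang_pos v
  push_cast
  set x : ℝ := ((hang φ v).card : ℝ)
  rw [add_sub_cancel_right]
  field_simp
  ring

lemma three_le_deg (hv : v ∈ core φ) (hs : 2 ≤ (hang φ v).card) : 3 ≤ deg φ v := by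
  rw [deg_of_mem_core hv]
  by_contra! hlt
  have : kids φ v = ∅ := Finset.card_eq_zero.1 (by omega)
  rw [card_hang_of_kids_eq_empty this] at hs
  omega

lemma coreExcess_of_four_le_deg (hd : 4 ≤ deg φ v)
    (h : ¬ IsCenterStarAt φ v) : 13 ≤ coreExcess φ v := by
  unfold IsCenterStarAt at h
  push Not at h
  obtain ⟨c, hc, hne⟩ := h
  have h14 := fourteen_le_excess (kids_notMem_core hc) hne (by rw [map_kids hc]; omega)
  have hsum : excess φ c ≤ ∑ c ∈ kids φ v, excess φ c :=
    Finset.single_le_sum (f := fun c => excess φ c) (fun b hb =>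
      excess_nonneg (kids_notMem_core hb)) hc
  unfold coreExcess
  linarith

/-- Degree 3 leaves a single branch, so this is `excess_trichotomy` with sizes shifted by one for
the root, whose own share is -1. -/
lemma coreExcess_of_deg_eq_three (hv : v ∈ core φ) (hd : deg φ v = 3)
    (hs : 3 ≤ (hang φ v).card) :
    (IsLeafStarAt φ v ∧
      coreExcess φ v = edgeWeight ((hang φ v).card - 1) 3 + 1 + tail ((hang φ v).card - 2)) ∨
    (IsZTreeAt φ v ∧ coreExcess φ v = 16 + tail ((hang φ v).card - 3)) ∨
    16 + tail ((hang φ v).card - 3) < coreExcess φ v := by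
  have hk : (kids φ v).card = 1 := by rw [deg_of_mem_core hv] at hd; omega
  obtain ⟨w, hw⟩ := Finset.card_eq_one.1 hk
  have hwk : w ∈ kids φ v := by simp [hw]
  have hcard : (hang φ v).card = (hang φ w).card + 1 := by
    rw [card_hang v, hw, Finset.sum_singleton, add_comm]
  have hne : (kids φ w).Nonempty := by
    rw [Finset.nonempty_iff_ne_empty]
    intro h0
    have := card_hang_of_kids_eq_empty h0
    omega
  have hx : coreExcess φ v = excess φ w - 1 := by rw [coreExcess, hw, Finset.sum_singleton]
  have e1 : (((hang φ v).card : ℝ) - 1) = (hang φ w).card := by rw [hcard]; push_cast; ring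
  have e2 : (((hang φ v).card : ℝ) - 2) = (hang φ w).card - 1 := by rw [hcard]; push_cast; ring
  have e3 : (((hang φ v).card : ℝ) - 3) = (hang φ w).card - 2 := by rw [hcard]; push_cast; ring
  rw [e1, e2, e3, hx]
  rcases excess_trichotomy (kids_notMem_core hwk) hne (by rw [map_kids hwk, hd]) with
    ⟨h1, h2⟩ | ⟨⟨c, h1, h1'⟩, h2⟩ | h2
  · exact Or.inl ⟨⟨w, hw, h1⟩, by rw [h2]; ring⟩
  · exact Or.inr (Or.inl ⟨⟨w, c, hw, h1, h1'⟩, by rw [h2]; ring⟩)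
  · exact Or.inr (Or.inr (by linarith))

lemma coreExcess_of_isLeafStarAt (hv : v ∈ core φ) (h : IsLeafStarAt φ v) :
    coreExcess φ v = edgeWeight ((hang φ v).card - 1) 3 + 1 + tail ((hang φ v).card - 2) ∧
      deg φ v = 3 := by
  obtain ⟨w, hw, hs⟩ := h
  have hd : deg φ v = 3 := by rw [deg_of_mem_core hv, hw, Finset.card_singleton]
  have hwk : w ∈ kids φ v := by simp [hw]
  have hcard : (hang φ v).card = (hang φ w).card + 1 := by
    rw [card_hang v, hw, Finset.sum_singleton, add_comm]
  refine ⟨?_, hd⟩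
  rw [coreExcess, hw, Finset.sum_singleton, excess_of_isStar (kids_notMem_core hwk) hs,
    map_kids hwk, hd, hcard]
  push_cast
  ring_nf

lemma coreExcess_of_isZTreeAt (hv : v ∈ core φ) (h : IsZTreeAt φ v) :
    coreExcess φ v = 16 + tail ((hang φ v).card - 3) ∧ deg φ v = 3 := by
  obtain ⟨w, c, hw, hc, hs⟩ := h
  have hd : deg φ v = 3 := by rw [deg_of_mem_core hv, hw, Finset.card_singleton]
  have hwk : w ∈ kids φ v := by simp [hw]
  have hck : c ∈ kids φ w := by simp [hc]
  have hdw : deg φ w = 2 := by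
    rw [deg_of_notMem_core (kids_notMem_core hwk), hc, Finset.card_singleton]
  have hcard : (hang φ v).card = (hang φ c).card + 2 := by
    rw [card_hang v, hw, Finset.sum_singleton, card_hang w, hc, Finset.sum_singleton]; omega
  have h2 : (2 : ℝ) ≤ (hang φ c).card := by exact_mod_cast hs.two_le_card
  refine ⟨?_, hd⟩
  rw [coreExcess, hw, Finset.sum_singleton, excess_eq, hc, Finset.sum_singleton,
    excess_of_isStar (kids_notMem_core hck) hs, map_kids hck, map_kids hwk, hd, hdw, hcard,
    Nat.cast_two, edgeWeight_two (by norm_num), edgeWeight_comm, edgeWeight_two h2]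
  push_cast
  ring_nf

end ParentMap

-- Each vertex pays for its outgoing edge, and 1 per vertex is split off. The arrows leaving cycle
-- vertices are exactly the cycle edges, so they separate from the trees.
open ParentMap in
lemma SimpleGraph.IsOrientedBy.augmentedZagrebIndex_eq_sum_core {V : Type*} [Fintype V]
    {G : SimpleGraph V} {φ : V → V} (h : G.IsOrientedBy φ) :
    augmentedZagrebIndex G = Fintype.card V +
      ∑ v ∈ core φ, (edgeWeight (deg φ v) (deg φ (φ v)) + coreExcess φ v) := by
  have h1 := sum_univ φ fun x => edgeWeight (deg φ x) (deg φ (φ x)) - 1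
  rw [Finset.sum_sub_distrib, ← h.augmentedZagrebIndex_eq] at h1
  simp only [Finset.sum_const, Finset.card_univ, nsmul_eq_mul, mul_one] at h1
  have h2 : ∑ v ∈ core φ, ∑ u ∈ hang φ v, (edgeWeight (deg φ u) (deg φ (φ u)) - 1) =
      ∑ v ∈ core φ, (edgeWeight (deg φ v) (deg φ (φ v)) + coreExcess φ v) :=
    Finset.sum_congr rfl fun v _ => by
      rw [← excess, excess_eq, coreExcess]; ring
  linarith

/-! ### Triangles, and recognising a graph from its three hanging trees. -/

namespace ParentMap

variable {V : Type*} [Fintype V] {φ : V → V} {u v w c : V}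

/-- `u` enumerates the cycle of `φ`, which has length three. -/
structure IsTriangle (φ : V → V) (u : Fin 3 → V) : Prop where
  injective : Injective u
  mem_core_iff : ∀ v, v ∈ core φ ↔ ∃ i, u i = v

lemma IsTriangle.mem_core {u : Fin 3 → V} (hu : IsTriangle φ u) (i : Fin 3) : u i ∈ core φ :=
  (hu.mem_core_iff _).2 ⟨i, rfl⟩

lemma IsTriangle.comp {u : Fin 3 → V} (hu : IsTriangle φ u) (σ : Equiv.Perm (Fin 3)) :
    IsTriangle φ (u ∘ σ) where
  injective := hu.injective.comp σ.injective
  mem_core_iff v := by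
    rw [hu.mem_core_iff, ← σ.exists_congr_right]; rfl

lemma IsTriangle.core_eq [DecidableEq V] {u : Fin 3 → V} (hu : IsTriangle φ u) :
    core φ = {u 0, u 1, u 2} := by
  ext v
  rw [hu.mem_core_iff, Fin.exists_fin_succ, Fin.exists_fin_two]
  simp [eq_comm]

lemma IsTriangle.sum_core {u : Fin 3 → V} (hu : IsTriangle φ u) {M : Type*} [AddCommMonoid M]
    (F : V → M) : ∑ v ∈ core φ, F v = F (u 0) + F (u 1) + F (u 2) := by
  classical
  have h01 : u 0 ≠ u 1 := hu.injective.ne (by decide)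
  have h02 : u 0 ≠ u 2 := hu.injective.ne (by decide)
  have h12 : u 1 ≠ u 2 := hu.injective.ne (by decide)
  rw [hu.core_eq, Finset.sum_insert (by simp [h01, h02]), Finset.sum_insert (by simp [h12]),
    Finset.sum_singleton, add_assoc]

lemma exists_isTriangle (h : (core φ).card = 3) : ∃ u, IsTriangle φ u := by
  have e := (Finset.equivFinOfCardEq h).symm
  refine ⟨fun i => (e i).1, fun i j hij => e.injective (Subtype.ext hij), fun v => ?_⟩
  constructor
  · intro hv
    exact ⟨e.symm ⟨v, hv⟩, by simp⟩
  · rintro ⟨i, rfl⟩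
    exact (e i).2

lemma IsTriangle.map_cases {G : SimpleGraph V} (h : G.IsOrientedBy φ) {u : Fin 3 → V}
    (hu : IsTriangle φ u) :
    (φ (u 0) = u 1 ∧ φ (u 1) = u 2 ∧ φ (u 2) = u 0) ∨
      (φ (u 0) = u 2 ∧ φ (u 2) = u 1 ∧ φ (u 1) = u 0) := by
  have key : ∀ i, φ (u i) = u 0 ∨ φ (u i) = u 1 ∨ φ (u i) = u 2 := by
    intro i
    obtain ⟨j, hj⟩ := (hu.mem_core_iff _).1 (map_mem_core (hu.mem_core i))
    rw [← hj]
    fin_cases j <;> simp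
  have h0 := h.map_ne (u 0)
  have h1 := h.map_ne (u 1)
  have h2 := h.map_ne (u 2)
  have h0' := h.map_map_ne (u 0)
  have h1' := h.map_map_ne (u 1)
  have h2' := h.map_map_ne (u 2)
  rcases key 0 with k0 | k0 | k0 <;> rcases key 1 with k1 | k1 | k1 <;>
    rcases key 2 with k2 | k2 | k2 <;> simp_all

lemma IsTriangle.augmentedZagrebIndex_eq {G : SimpleGraph V} (h : G.IsOrientedBy φ)
    {u : Fin 3 → V} (hu : IsTriangle φ u) :
    augmentedZagrebIndex G = Fintype.card V +
      (edgeWeight (deg φ (u 0)) (deg φ (u 1)) + edgeWeight (deg φ (u 1)) (deg φ (u 2)) +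
        edgeWeight (deg φ (u 0)) (deg φ (u 2))) +
      (coreExcess φ (u 0) + coreExcess φ (u 1) + coreExcess φ (u 2)) := by
  rw [h.augmentedZagrebIndex_eq_sum_core, hu.sum_core]
  rcases hu.map_cases h with ⟨h0, h1, h2⟩ | ⟨h0, h2, h1⟩ <;> rw [h0, h1, h2]
  · rw [edgeWeight_comm (deg φ (u 2)) (deg φ (u 0))]; ring
  · rw [edgeWeight_comm (deg φ (u 1)) (deg φ (u 0)), edgeWeight_comm (deg φ (u 2)) (deg φ (u 1))]
    ring

lemma IsTriangle.adj {G : SimpleGraph V} (h : G.IsOrientedBy φ) {u : Fin 3 → V}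
    (hu : IsTriangle φ u) {i j : Fin 3} (hij : i ≠ j) : G.Adj (u i) (u j) := by
  rw [h.adj_iff]
  rcases hu.map_cases h with ⟨h0, h1, h2⟩ | ⟨h0, h1, h2⟩ <;> fin_cases i <;> fin_cases j <;>
    simp_all

/-- `par` describes the rooted tree on `Fin q` with root `0`. -/
structure IsParent {q : ℕ} (T : SimpleGraph (Fin q)) (par : ℕ → ℕ) : Prop where
  adj_iff : ∀ i j : Fin q, T.Adj i j ↔
    (i.val ≠ 0 ∧ par i.val = j.val) ∨ (j.val ≠ 0 ∧ par j.val = i.val)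
  lt : ∀ a, a ≠ 0 → par a < a

/-- The parent map of `centerStar`. -/
def centerPar (_ : ℕ) : ℕ := 0

/-- The parent map of `leafStar`. -/
def leafPar (a : ℕ) : ℕ := if a = 1 then 0 else 1

/-- The parent map of `zTree`. -/
def zPar (a : ℕ) : ℕ := if a = 1 then 0 else if a = 2 then 1 else 2

lemma isParent_centerStar (q : ℕ) : IsParent (centerStar q) centerPar where
  adj_iff i j := by
    simp only [centerStar, SimpleGraph.fromRel_adj, centerPar, ne_eq, Fin.ext_iff]
    omega
  lt a ha := by unfold centerPar; omega

lemma isParent_leafStar (q : ℕ) : IsParent (leafStar q) leafPar where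
  adj_iff i j := by
    simp only [leafStar, SimpleGraph.fromRel_adj, leafPar, ne_eq, Fin.ext_iff]
    split_ifs <;> omega
  lt a ha := by unfold leafPar; split_ifs <;> omega

lemma isParent_zTree (q : ℕ) : IsParent (zTree q) zPar where
  adj_iff i j := by
    simp only [zTree, SimpleGraph.fromRel_adj, zPar, ne_eq, Fin.ext_iff]
    split_ifs <;> omega
  lt a ha := by unfold zPar; split_ifs <;> omega

/-- The tree hanging at `v` is the rooted tree on `Fin q` described by `par`. -/
def HangIso (φ : V → V) (v : V) (q : ℕ) (par : ℕ → ℕ) : Prop :=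
  ∃ e : hang φ v ≃ Fin q, (∀ x, (e x).val = 0 ↔ x.1 = v) ∧
    ∀ x y : hang φ v, x.1 ≠ v → φ x.1 = y.1 → (e y).val = par (e x).val

/-- `HangIso` only asks that `φ` be carried to the parent function. The converse follows by
injectivity of the numbering, because `φ` keeps non-root vertices inside the tree. -/
lemma HangIso.adj_iff {G : SimpleGraph V} (h : G.IsOrientedBy φ) {q : ℕ} {par : ℕ → ℕ}
    {T : SimpleGraph (Fin q)} (hT : IsParent T par) (hv : v ∈ core φ) {e : hang φ v ≃ Fin q}
    (he0 : ∀ x, (e x).val = 0 ↔ x.1 = v)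
    (he : ∀ x y : hang φ v, x.1 ≠ v → φ x.1 = y.1 → (e y).val = par (e x).val)
    (x y : hang φ v) : G.Adj x.1 y.1 ↔ T.Adj (e x) (e y) := by
  rw [h.adj_iff, hT.adj_iff]
  have key : ∀ x y : hang φ v, φ x.1 = y.1 ↔ (e x).val ≠ 0 ∧ par (e x).val = (e y).val := by
    intro x y
    constructor
    · intro hxy
      have hxv : x.1 ≠ v := by
        intro hx
        have h1 : φ v ∈ hang φ v := by
          have := y.2
          rwa [← hxy, hx] at this
        exact h.map_ne v ((mem_hang_iff_of_mem_core hv (map_mem_core hv)).1 h1)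
      exact ⟨fun h0 => hxv ((he0 x).1 h0), (he x y hxv hxy).symm⟩
    · rintro ⟨h0, h1⟩
      have hxv : x.1 ≠ v := fun hx => h0 ((he0 x).2 hx)
      have h2 := he x ⟨φ x.1, SimpleGraph.IsOrientedBy.map_mem_hang x.2 hxv⟩ hxv rfl
      have h3 : (⟨φ x.1, SimpleGraph.IsOrientedBy.map_mem_hang x.2 hxv⟩ : hang φ v) = y :=
        e.injective (Fin.ext (h2.trans h1))
      exact congrArg Subtype.val h3
  rw [key x y, key y x]

/-- The hanging trees partition the vertices, so their numberings glue to a bijection. An edge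
between different trees must join two roots, and any two roots of a triangle are adjacent. -/
lemma nonempty_iso_triangleWithTrees {G : SimpleGraph V} (h : G.IsOrientedBy φ) {u : Fin 3 → V}
    (hu : IsTriangle φ u) {T : Fin 3 → (q : ℕ) → SimpleGraph (Fin q)} {s : Fin 3 → ℕ}
    {par : Fin 3 → ℕ → ℕ} (hT : ∀ i, IsParent (T i (s i)) (par i))
    (hs : ∀ i, HangIso φ (u i) (s i) (par i)) : Nonempty (G ≃g triangleWithTrees T s) := by
  choose e he0 he using hs
  let f : (Σ i : Fin 3, Fin (s i)) → V := fun x => ((e x.1).symm x.2).1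
  have hmem : ∀ x, f x ∈ hang φ (u x.1) := fun x => ((e x.1).symm x.2).2
  have hdisj : ∀ {i j : Fin 3} {x : V}, x ∈ hang φ (u i) → x ∈ hang φ (u j) → i = j := by
    intro i j x hi hj
    by_contra hij
    exact Finset.disjoint_left.1 (disjoint_hang_of_mem_core (hu.mem_core i) (hu.mem_core j)
      (hu.injective.ne hij)) hi hj
  have hbij : Bijective f := by
    constructor
    · rintro ⟨i, a⟩ ⟨j, b⟩ hab
      obtain rfl : i = j := hdisj (hmem ⟨i, a⟩) (hab ▸ hmem ⟨j, b⟩)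
      have : a = b := (e i).symm.injective (Subtype.ext hab)
      rw [this]
    · intro x
      obtain ⟨v, hv, hx⟩ := exists_mem_hang φ x
      obtain ⟨i, rfl⟩ := (hu.mem_core_iff v).1 hv
      exact ⟨⟨i, e i ⟨x, hx⟩⟩, by simp [f]⟩
  have hadj : ∀ x y, G.Adj (f x) (f y) ↔ (triangleWithTrees T s).Adj x y := by
    rintro ⟨i, a⟩ ⟨j, b⟩
    by_cases hij : i = j
    · subst hij
      have h1 := HangIso.adj_iff h (hT i) (hu.mem_core i) (he0 i) (he i) ((e i).symm a)
        ((e i).symm b)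
      rw [Equiv.apply_symm_apply, Equiv.apply_symm_apply] at h1
      refine h1.trans ⟨fun hab => Or.inl ⟨i, a, b, rfl, rfl, hab⟩, ?_⟩
      rintro (⟨i', a', b', ha, hb, hab⟩ | ⟨hne, -⟩)
      · obtain ⟨rfl, ha⟩ := Sigma.mk.inj_iff.1 ha
        obtain ⟨-, hb⟩ := Sigma.mk.inj_iff.1 hb
        rw [heq_iff_eq] at ha hb
        rwa [ha, hb]
      · exact absurd rfl hne
    · have hroot : ∀ (i : Fin 3) (a : Fin (s i)), f ⟨i, a⟩ = u i ↔ a.val = 0 := by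
        intro i a
        rw [← he0 i, Equiv.apply_symm_apply]
      have key : ∀ (i j : Fin 3) (a : Fin (s i)) (b : Fin (s j)), i ≠ j →
          φ (f ⟨i, a⟩) = f ⟨j, b⟩ → a.val = 0 ∧ b.val = 0 := by
        intro i j a b hij hab
        have ha : f ⟨i, a⟩ = u i := by
          by_contra hne
          have := SimpleGraph.IsOrientedBy.map_mem_hang (hmem ⟨i, a⟩) hne
          rw [hab] at this
          exact hij (hdisj this (hmem ⟨j, b⟩))
        have hb : f ⟨j, b⟩ = u j := by
          refine (mem_hang_iff_of_mem_core (hu.mem_core j) ?_).1 (hmem ⟨j, b⟩)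
          rw [← hab, ha]
          exact map_mem_core (hu.mem_core i)
        exact ⟨(hroot i a).1 ha, (hroot j b).1 hb⟩
      constructor
      · intro hab
        refine Or.inr ⟨hij, ?_⟩
        rcases (h.adj_iff _ _).1 hab with h1 | h1
        · exact key i j a b hij h1
        · exact (key j i b a (Ne.symm hij) h1).symm
      · rintro (⟨i', a', b', ha, hb, hab⟩ | ⟨-, ha, hb⟩)
        · obtain ⟨rfl, -⟩ := Sigma.mk.inj_iff.1 ha
          obtain ⟨rfl, -⟩ := Sigma.mk.inj_iff.1 hb
          exact absurd rfl hij
        · rw [(hroot i a).2 ha, (hroot j b).2 hb]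
          exact hu.adj h hij
  exact ⟨(⟨Equiv.ofBijective f hbij, fun {x y} => hadj x y⟩ : triangleWithTrees T s ≃g G).symm⟩

/-- Adjust a bijection so that one more value is prescribed. -/
lemma _root_.Equiv.exists_apply_eq {α β : Type*} (e : α ≃ β) (a : α) (b : β) :
    ∃ e' : α ≃ β, e' a = b ∧ ∀ x, x ≠ a → e x ≠ b → e' x = e x := by
  classical
  refine ⟨e.trans (Equiv.swap (e a) b), by simp, fun x hx hb => ?_⟩
  simp only [Equiv.trans_apply]
  exact Equiv.swap_apply_of_ne_of_ne (e.injective.ne hx) hb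

/-- Only the inner vertices need prescribed labels; the leaves may be numbered arbitrarily. An
arbitrary bijection is therefore corrected by swaps, here one for the root. -/
lemma hangIso_of_isCenterStarAt (h : IsCenterStarAt φ v) :
    HangIso φ v (hang φ v).card centerPar := by
  have e0 := Finset.equivFin (hang φ v)
  obtain ⟨e, he, -⟩ := e0.exists_apply_eq ⟨v, self_mem_hang v⟩ ⟨0, card_hang_pos v⟩
  have hiff : ∀ x, (e x).val = 0 ↔ x.1 = v := by
    intro x
    have : (e x).val = 0 ↔ e x = e ⟨v, self_mem_hang v⟩ := by rw [he, Fin.ext_iff]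
    rw [this, e.injective.eq_iff, Subtype.ext_iff]
  refine ⟨e, hiff, fun x y hx hxy => ?_⟩
  rw [centerPar, hiff, ← hxy]
  rcases mem_hang_iff.1 x.2 with h1 | ⟨w, hw, hxw⟩
  · exact absurd h1 hx
  · rcases mem_hang_iff.1 hxw with h1 | ⟨z, hz, -⟩
    · rw [h1, map_kids hw]
    · simp [h w hw] at hz

lemma hangIso_of_isLeafStarAt (h : IsLeafStarAt φ v) : HangIso φ v (hang φ v).card leafPar := by
  obtain ⟨w, hw, hs⟩ := h
  have hwk : w ∈ kids φ v := by simp [hw]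
  have hcard := card_hang_lt_of_mem_kids hwk
  have h2 := hs.two_le_card
  have hwv : w ∈ hang φ v := mem_hang_iff.2 (Or.inr ⟨w, hwk, self_mem_hang w⟩)
  have hne : v ≠ w := by
    rintro rfl
    exact notMem_hang_of_mem_kids hwk (self_mem_hang _)
  have e0 := Finset.equivFin (hang φ v)
  obtain ⟨e1, he1, -⟩ := e0.exists_apply_eq ⟨v, self_mem_hang v⟩ ⟨0, card_hang_pos v⟩
  obtain ⟨e, hew, he⟩ := e1.exists_apply_eq ⟨w, hwv⟩ ⟨1, by omega⟩
  have hev : e ⟨v, self_mem_hang v⟩ = ⟨0, card_hang_pos v⟩ := by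
    rw [he _ (by simpa using hne) (by rw [he1]; simp), he1]
  have hiff0 : ∀ x, (e x).val = 0 ↔ x.1 = v := by
    intro x
    have : (e x).val = 0 ↔ e x = e ⟨v, self_mem_hang v⟩ := by rw [hev, Fin.ext_iff]
    rw [this, e.injective.eq_iff, Subtype.ext_iff]
  have hiff1 : ∀ x, (e x).val = 1 ↔ x.1 = w := by
    intro x
    have : (e x).val = 1 ↔ e x = e ⟨w, hwv⟩ := by rw [hew, Fin.ext_iff]
    rw [this, e.injective.eq_iff, Subtype.ext_iff]
  refine ⟨e, hiff0, fun x y hx hxy => ?_⟩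
  unfold leafPar
  split_ifs with hx1
  · rw [hiff0, ← hxy, (hiff1 x).1 hx1, map_kids hwk]
  · rw [hiff1, ← hxy]
    rw [hiff1] at hx1
    rcases mem_hang_iff.1 x.2 with h1 | ⟨w', hw', hxw⟩
    · exact absurd h1 hx
    · obtain rfl : w' = w := by simpa [hw] using hw'
      rcases mem_hang_iff.1 hxw with h1 | ⟨z, hz, hxz⟩
      · exact absurd h1 hx1
      · rcases mem_hang_iff.1 hxz with h1 | ⟨z', hz', -⟩
        · rw [h1, map_kids hz]
        · simp [hs.2 z hz] at hz'

lemma hangIso_of_isZTreeAt (h : IsZTreeAt φ v) : HangIso φ v (hang φ v).card zPar := by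
  obtain ⟨w, c, hw, hc, hs⟩ := h
  have hwk : w ∈ kids φ v := by simp [hw]
  have hck : c ∈ kids φ w := by simp [hc]
  have hcard := card_hang_lt_of_mem_kids hwk
  have hcard' := card_hang_lt_of_mem_kids hck
  have h2 := hs.two_le_card
  have hwv : w ∈ hang φ v := mem_hang_iff.2 (Or.inr ⟨w, hwk, self_mem_hang w⟩)
  have hcw : c ∈ hang φ w := mem_hang_iff.2 (Or.inr ⟨c, hck, self_mem_hang c⟩)
  have hcv : c ∈ hang φ v := mem_hang_iff.2 (Or.inr ⟨w, hwk, hcw⟩)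
  have hne : v ≠ w := by
    rintro rfl
    exact notMem_hang_of_mem_kids hwk (self_mem_hang _)
  have hne' : w ≠ c := by
    rintro rfl
    exact notMem_hang_of_mem_kids hck (self_mem_hang _)
  have hne'' : v ≠ c := fun hvc => notMem_hang_of_mem_kids hwk (hvc ▸ hcw)
  have e0 := Finset.equivFin (hang φ v)
  obtain ⟨e1, he1, -⟩ := e0.exists_apply_eq ⟨v, self_mem_hang v⟩ ⟨0, card_hang_pos v⟩
  obtain ⟨e2, he2w, he2⟩ := e1.exists_apply_eq ⟨w, hwv⟩ ⟨1, by omega⟩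
  have he2v : e2 ⟨v, self_mem_hang v⟩ = ⟨0, card_hang_pos v⟩ := by
    rw [he2 _ (by simpa using hne) (by rw [he1]; simp), he1]
  obtain ⟨e, hec, he⟩ := e2.exists_apply_eq ⟨c, hcv⟩ ⟨2, by omega⟩
  have hev : e ⟨v, self_mem_hang v⟩ = ⟨0, card_hang_pos v⟩ := by
    rw [he _ (by simpa using hne'') (by rw [he2v]; simp), he2v]
  have hew : e ⟨w, hwv⟩ = ⟨1, by omega⟩ := by
    rw [he _ (by simpa using hne') (by rw [he2w]; simp), he2w]
  have hiff0 : ∀ x, (e x).val = 0 ↔ x.1 = v := by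
    intro x
    have : (e x).val = 0 ↔ e x = e ⟨v, self_mem_hang v⟩ := by rw [hev, Fin.ext_iff]
    rw [this, e.injective.eq_iff, Subtype.ext_iff]
  have hiff1 : ∀ x, (e x).val = 1 ↔ x.1 = w := by
    intro x
    have : (e x).val = 1 ↔ e x = e ⟨w, hwv⟩ := by rw [hew, Fin.ext_iff]
    rw [this, e.injective.eq_iff, Subtype.ext_iff]
  have hiff2 : ∀ x, (e x).val = 2 ↔ x.1 = c := by
    intro x
    have : (e x).val = 2 ↔ e x = e ⟨c, hcv⟩ := by rw [hec, Fin.ext_iff]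
    rw [this, e.injective.eq_iff, Subtype.ext_iff]
  refine ⟨e, hiff0, fun x y hx hxy => ?_⟩
  unfold zPar
  split_ifs with hx1 hx2
  · rw [hiff0, ← hxy, (hiff1 x).1 hx1, map_kids hwk]
  · rw [hiff1, ← hxy, (hiff2 x).1 hx2, map_kids hck]
  · rw [hiff2, ← hxy]
    rw [hiff1] at hx1
    rw [hiff2] at hx2
    rcases mem_hang_iff.1 x.2 with h1 | ⟨w', hw', hxw⟩
    · exact absurd h1 hx
    · obtain rfl : w' = w := by simpa [hw] using hw'
      rcases mem_hang_iff.1 hxw with h1 | ⟨c', hc', hxc⟩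
      · exact absurd h1 hx1
      · obtain rfl : c' = c := by simpa [hc] using hc'
        rcases mem_hang_iff.1 hxc with h1 | ⟨z, hz, hxz⟩
        · exact absurd h1 hx2
        · rcases mem_hang_iff.1 hxz with h1 | ⟨z', hz', -⟩
          · rw [h1, map_kids hz]
          · simp [hs.2 z hz] at hz'

end ParentMap

/-! ### The displayed graphs as graphs of self-maps. -/

namespace ParentMap

section Display

variable {s : Fin 3 → ℕ} {par : Fin 3 → ℕ → ℕ}

/-- The orientation of `triangleWithTrees` given by the parent maps of the three trees. -/
def triangleMap (s : Fin 3 → ℕ) (par : Fin 3 → ℕ → ℕ) (hs : ∀ i, 0 < s i)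
    (hpar : ∀ i a, a ≠ 0 → par i a < a) (x : Σ i : Fin 3, Fin (s i)) : Σ i : Fin 3, Fin (s i) :=
  if h : x.2.val = 0 then ⟨x.1 + 1, ⟨0, hs _⟩⟩
  else ⟨x.1, ⟨par x.1 x.2.val, (hpar _ _ h).trans x.2.isLt⟩⟩

variable {hs : ∀ i, 0 < s i} {hpar : ∀ i a, a ≠ 0 → par i a < a}

lemma triangleMap_zero (i : Fin 3) {a : Fin (s i)} (ha : a.val = 0) :
    triangleMap s par hs hpar ⟨i, a⟩ = ⟨i + 1, ⟨0, hs _⟩⟩ := dif_pos ha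

lemma triangleMap_of_ne (i : Fin 3) {a : Fin (s i)} (ha : a.val ≠ 0) :
    triangleMap s par hs hpar ⟨i, a⟩ = ⟨i, ⟨par i a.val, (hpar _ _ ha).trans a.isLt⟩⟩ :=
  dif_neg ha

lemma sigma_fin_ext_iff {i j : Fin 3} {a : Fin (s i)} {b : Fin (s j)} :
    (⟨i, a⟩ : Σ i : Fin 3, Fin (s i)) = ⟨j, b⟩ ↔ i = j ∧ a.val = b.val := by
  constructor
  · intro h
    obtain ⟨rfl, h⟩ := Sigma.mk.inj_iff.1 h
    exact ⟨rfl, congrArg Fin.val (eq_of_heq h)⟩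
  · rintro ⟨rfl, h⟩
    rw [Fin.ext h]

lemma exists_iterate_triangleMap_root (m : ℕ) : ∀ (i : Fin 3) (a : Fin (s i)), a.val = m →
    ∃ t, (triangleMap s par hs hpar)^[t] ⟨i, a⟩ = ⟨i, ⟨0, hs i⟩⟩ := by
  induction m using Nat.strong_induction_on with
  | _ m ih =>
    intro i a ha
    by_cases h0 : a.val = 0
    · exact ⟨0, sigma_fin_ext_iff.2 ⟨rfl, h0⟩⟩
    · obtain ⟨t, ht⟩ := ih (par i a.val) (ha ▸ hpar i _ h0) i
        ⟨par i a.val, (hpar i _ h0).trans a.isLt⟩ rfl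
      exact ⟨t + 1, by rw [iterate_succ_apply, triangleMap_of_ne i h0, ht]⟩

lemma isOrientedBy_triangleMap {T : Fin 3 → (q : ℕ) → SimpleGraph (Fin q)}
    (hT : ∀ i, IsParent (T i (s i)) (par i)) :
    (triangleWithTrees T s).IsOrientedBy (triangleMap s par hs hpar) where
  adj_iff := by
    rintro ⟨i, a⟩ ⟨j, b⟩
    have hmap : ∀ (i j : Fin 3) (a : Fin (s i)) (b : Fin (s j)),
        triangleMap s par hs hpar ⟨i, a⟩ = ⟨j, b⟩ ↔
          (a.val = 0 ∧ i + 1 = j ∧ b.val = 0) ∨ (a.val ≠ 0 ∧ i = j ∧ par i a.val = b.val) := by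
      intro i j a b
      by_cases ha : a.val = 0
      · rw [triangleMap_zero i ha, sigma_fin_ext_iff]
        simp [ha, eq_comm]
      · rw [triangleMap_of_ne i ha, sigma_fin_ext_iff]
        simp [ha]
    rw [hmap, hmap]
    by_cases hij : i = j
    · subst hij
      have hi : i + 1 ≠ i := (by decide : ∀ i : Fin 3, i + 1 ≠ i) i
      have hadj : (triangleWithTrees T s).Adj ⟨i, a⟩ ⟨i, b⟩ ↔ (T i (s i)).Adj a b := by
        constructor
        · rintro (⟨i', a', b', ha, hb, hab⟩ | ⟨hne, -⟩)
          · obtain ⟨rfl, ha⟩ := Sigma.mk.inj_iff.1 ha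
            obtain ⟨-, hb⟩ := Sigma.mk.inj_iff.1 hb
            rw [heq_iff_eq] at ha hb
            rwa [ha, hb]
          · exact absurd rfl hne
        · exact fun hab => Or.inl ⟨i, a, b, rfl, rfl, hab⟩
      rw [hadj, (hT i).adj_iff]
      simp [hi]
    · have hadj : (triangleWithTrees T s).Adj ⟨i, a⟩ ⟨j, b⟩ ↔ a.val = 0 ∧ b.val = 0 := by
        constructor
        · rintro (⟨i', a', b', ha, hb, hab⟩ | ⟨-, h⟩)
          · obtain ⟨rfl, -⟩ := Sigma.mk.inj_iff.1 ha
            obtain ⟨rfl, -⟩ := Sigma.mk.inj_iff.1 hb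
            exact absurd rfl hij
          · exact h
        · exact fun h => Or.inr ⟨hij, h⟩
      rw [hadj]
      have hcyc : i + 1 = j ∨ j + 1 = i :=
        (by decide : ∀ i j : Fin 3, i ≠ j → i + 1 = j ∨ j + 1 = i) i j hij
      simp only [hij, Ne.symm hij, false_and, and_false, or_false]
      tauto
  map_map_ne := by
    rintro ⟨i, a⟩ hx
    have hi : i + 1 ≠ i ∧ i + 1 + 1 ≠ i :=
      (by decide : ∀ i : Fin 3, i + 1 ≠ i ∧ i + 1 + 1 ≠ i) i
    by_cases ha : a.val = 0
    · rw [triangleMap_zero i ha, triangleMap_zero _ rfl, sigma_fin_ext_iff] at hx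
      exact hi.2 hx.1
    · rw [triangleMap_of_ne i ha] at hx
      by_cases hp : par i a.val = 0
      · rw [triangleMap_zero i hp, sigma_fin_ext_iff] at hx
        exact hi.1 hx.1
      · rw [triangleMap_of_ne i hp, sigma_fin_ext_iff] at hx
        have h1 := hpar i _ ha
        have h2 := hpar i _ hp
        have h3 : par i (par i a.val) = a.val := hx.2
        omega
  reach := by
    refine ⟨⟨0, ⟨0, hs 0⟩⟩, ?_⟩
    rintro ⟨i, a⟩
    obtain ⟨t, ht⟩ := exists_iterate_triangleMap_root (hs := hs) (hpar := hpar) a.val i a rfl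
    have hr : ∃ t', (triangleMap s par hs hpar)^[t'] ⟨i, ⟨0, hs i⟩⟩ = ⟨0, ⟨0, hs 0⟩⟩ := by
      have h1 : ∀ i : Fin 3, triangleMap s par hs hpar ⟨i, ⟨0, hs i⟩⟩ =
        ⟨i + 1, ⟨0, hs (i + 1)⟩⟩ := fun i => triangleMap_zero i rfl
      have hcases : i = 0 ∨ i + 1 = 0 ∨ i + 1 + 1 = 0 :=
        (by decide : ∀ i : Fin 3, i = 0 ∨ i + 1 = 0 ∨ i + 1 + 1 = 0) i
      rcases hcases with h | h | h
      · subst h; exact ⟨0, rfl⟩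
      · refine ⟨1, ?_⟩
        rw [iterate_one, h1, sigma_fin_ext_iff]
        exact ⟨h, rfl⟩
      · refine ⟨2, ?_⟩
        rw [iterate_succ_apply, iterate_one, h1, h1, sigma_fin_ext_iff]
        exact ⟨h, rfl⟩
    obtain ⟨t', ht'⟩ := hr
    exact ⟨t' + t, by rw [iterate_add_apply, ht, ht']⟩

/-- The roots are permuted cyclically. Every vertex reaches a root and the orbit then stays among
the roots, so a periodic point is itself a root. -/
lemma mem_core_triangleMap (x : Σ i : Fin 3, Fin (s i)) :
    x ∈ core (triangleMap s par hs hpar) ↔ x.2.val = 0 := by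
  have hroot : ∀ i : Fin 3, (⟨i, ⟨0, hs i⟩⟩ : Σ i : Fin 3, Fin (s i)) ∈
      core (triangleMap s par hs hpar) := by
    intro i
    refine mem_core_of_iterate_eq (i := 3) (by omega) ?_
    rw [iterate_succ_apply, iterate_succ_apply, iterate_one, triangleMap_zero i rfl,
      triangleMap_zero _ rfl, triangleMap_zero _ rfl, sigma_fin_ext_iff]
    exact ⟨(by decide : ∀ i : Fin 3, i + 1 + 1 + 1 = i) i, rfl⟩
  constructor
  · intro hx
    have hstep : ∀ t, ∀ y : Σ i : Fin 3, Fin (s i), y.2.val = 0 →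
        ((triangleMap s par hs hpar)^[t] y).2.val = 0 := by
      intro t
      induction t with
      | zero => exact fun y hy => hy
      | succ t ih =>
        rintro ⟨i, a⟩ hy
        rw [iterate_succ_apply, triangleMap_zero i hy]
        exact ih _ rfl
    obtain ⟨m, hm, hp⟩ := mem_core.1 hx
    obtain ⟨i, a⟩ := x
    obtain ⟨t, ht⟩ := exists_iterate_triangleMap_root (hs := hs) (hpar := hpar) a.val i a rfl
    have h1 : (triangleMap s par hs hpar)^[t * m] ⟨i, a⟩ = ⟨i, a⟩ := hp.const_mul t
    have hle : t ≤ t * m := Nat.le_mul_of_pos_right t hm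
    rw [← Nat.sub_add_cancel hle, iterate_add_apply, ht] at h1
    rw [← h1]
    exact hstep _ _ rfl
  · obtain ⟨i, a⟩ := x
    intro ha
    have : (⟨i, a⟩ : Σ i : Fin 3, Fin (s i)) = ⟨i, ⟨0, hs i⟩⟩ := sigma_fin_ext_iff.2 ⟨rfl, ha⟩
    rw [this]
    exact hroot i

lemma isTriangle_triangleMap :
    IsTriangle (triangleMap s par hs hpar) fun i => ⟨i, ⟨0, hs i⟩⟩ where
  injective i j hij := (sigma_fin_ext_iff.1 hij).1
  mem_core_iff := by
    rintro ⟨i, a⟩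
    rw [mem_core_triangleMap]
    simp only [sigma_fin_ext_iff]
    exact ⟨fun h => ⟨i, rfl, h.symm⟩, fun ⟨_, _, h⟩ => h.symm⟩

lemma mem_kids_triangleMap {i j : Fin 3} {a : Fin (s i)} {b : Fin (s j)} :
    (⟨i, a⟩ : Σ i : Fin 3, Fin (s i)) ∈ kids (triangleMap s par hs hpar) ⟨j, b⟩ ↔
      i = j ∧ a.val ≠ 0 ∧ par i a.val = b.val := by
  rw [mem_kids, mem_core_triangleMap]
  by_cases ha : a.val = 0
  · simp [ha]
  · rw [triangleMap_of_ne i ha, sigma_fin_ext_iff]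
    simp [ha]

lemma mem_hang_triangleMap {i j : Fin 3} {a : Fin (s j)} :
    (⟨j, a⟩ : Σ i : Fin 3, Fin (s i)) ∈ hang (triangleMap s par hs hpar) ⟨i, ⟨0, hs i⟩⟩ ↔
      j = i := by
  have key : ∀ m, ∀ (i : Fin 3) (a : Fin (s i)), a.val = m → (⟨i, a⟩ : Σ i : Fin 3, Fin (s i)) ∈
      hang (triangleMap s par hs hpar) ⟨i, ⟨0, hs i⟩⟩ := by
    intro m
    induction m using Nat.strong_induction_on with
    | _ m ih =>
      intro i a ha
      by_cases h0 : a.val = 0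
      · rw [(sigma_fin_ext_iff.2 ⟨rfl, h0⟩ : (⟨i, a⟩ : Σ i : Fin 3, Fin (s i)) = ⟨i, ⟨0, hs i⟩⟩)]
        exact self_mem_hang _
      -- Parents have smaller labels, so induction applies to the parent. An arrow entering the tree
      -- from outside would start at a periodic point, hence at a label 0.
      · by_contra hcon
        have h1 := ih _ (ha ▸ hpar i _ h0) i ⟨par i a.val, (hpar i _ h0).trans a.isLt⟩ rfl
        rw [← triangleMap_of_ne (hs := hs) (hpar := hpar) i h0] at h1
        have h2 := SimpleGraph.IsOrientedBy.map_mem_core_of_map_mem_hang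
          ((isTriangle_triangleMap (hs := hs) (hpar := hpar)).mem_core i) h1 hcon
        exact h0 ((mem_core_triangleMap _).1 h2.2)
  refine ⟨fun h => ?_, fun h => ?_⟩
  · by_contra hne
    exact Finset.disjoint_left.1 (disjoint_hang_of_mem_core (isTriangle_triangleMap.mem_core j)
      (isTriangle_triangleMap.mem_core i)
      ((isTriangle_triangleMap (hs := hs) (hpar := hpar)).injective.ne hne))
      (key _ j a rfl) h
  · subst h
    exact key _ j a rfl

lemma card_hang_triangleMap (i : Fin 3) :
    (hang (triangleMap s par hs hpar) ⟨i, ⟨0, hs i⟩⟩).card = s i := by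
  classical
  have : hang (triangleMap s par hs hpar) ⟨i, ⟨0, hs i⟩⟩ =
      Finset.univ.map (Embedding.sigmaMk (β := fun i : Fin 3 => Fin (s i)) i) := by
    ext ⟨j, a⟩
    rw [mem_hang_triangleMap]
    simp only [Finset.mem_map, Finset.mem_univ, true_and]
    constructor
    · rintro rfl; exact ⟨a, rfl⟩
    · rintro ⟨b, hb⟩
      exact (sigma_fin_ext_iff.1 hb).1.symm
  rw [this]
  simp

lemma isCenterStarAt_triangleMap {i : Fin 3} (h : par i = centerPar) :
    IsCenterStarAt (triangleMap s par hs hpar) ⟨i, ⟨0, hs i⟩⟩ := by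
  rintro ⟨j, a⟩ ha
  obtain ⟨rfl, ha, -⟩ := mem_kids_triangleMap.1 ha
  rw [Finset.eq_empty_iff_forall_notMem]
  rintro ⟨j', b⟩ hb
  obtain ⟨rfl, hb, h2⟩ := mem_kids_triangleMap.1 hb
  rw [h, centerPar] at h2
  exact ha h2.symm

lemma kids_triangleMap_eq_singleton {i : Fin 3} {a b : Fin (s i)} (hb : b.val ≠ 0)
    (h : ∀ m, m ≠ 0 → (par i m = a.val ↔ m = b.val)) :
    kids (triangleMap s par hs hpar) ⟨i, a⟩ = {⟨i, b⟩} := by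
  ext ⟨j, c⟩
  rw [mem_kids_triangleMap, Finset.mem_singleton, sigma_fin_ext_iff]
  constructor
  · rintro ⟨rfl, hc, h1⟩
    exact ⟨rfl, (h _ hc).1 h1⟩
  · rintro ⟨rfl, hc⟩
    rw [hc]
    exact ⟨rfl, hb, (h _ hb).2 rfl⟩

lemma isStar_triangleMap {i : Fin 3} {a b : Fin (s i)} (hb : b.val ≠ 0) (hba : par i b.val = a.val)
    (h : ∀ m l, m ≠ 0 → l ≠ 0 → par i m = a.val → par i l ≠ m) :
    IsStar (triangleMap s par hs hpar) ⟨i, a⟩ := by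
  refine ⟨⟨⟨i, b⟩, mem_kids_triangleMap.2 ⟨rfl, hb, hba⟩⟩, ?_⟩
  rintro ⟨j, c⟩ hc
  obtain ⟨rfl, hc, hca⟩ := mem_kids_triangleMap.1 hc
  rw [Finset.eq_empty_iff_forall_notMem]
  rintro ⟨j', d⟩ hd
  obtain ⟨rfl, hd, hdc⟩ := mem_kids_triangleMap.1 hd
  exact h _ _ hc hd hca hdc

lemma isLeafStarAt_triangleMap {i : Fin 3} (h : par i = leafPar) (hi : 3 ≤ s i) :
    IsLeafStarAt (triangleMap s par hs hpar) ⟨i, ⟨0, hs i⟩⟩ := by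
  refine ⟨⟨i, ⟨1, by omega⟩⟩, kids_triangleMap_eq_singleton (by simp) ?_,
    isStar_triangleMap (b := ⟨2, by omega⟩) (by simp) (by simp [h, leafPar]) ?_⟩
  · intro m hm
    rw [h, leafPar]
    split_ifs <;> simp_all
  · intro m l hm hl
    rw [h, leafPar, leafPar]
    split_ifs <;> simp_all <;> omega

lemma isZTreeAt_triangleMap {i : Fin 3} (h : par i = zPar) (hi : 4 ≤ s i) :
    IsZTreeAt (triangleMap s par hs hpar) ⟨i, ⟨0, hs i⟩⟩ := by
  refine ⟨⟨i, ⟨1, by omega⟩⟩, ⟨i, ⟨2, by omega⟩⟩, kids_triangleMap_eq_singleton (by simp) ?_,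
    kids_triangleMap_eq_singleton (by simp) ?_,
    isStar_triangleMap (b := ⟨3, by omega⟩) (by simp) (by simp [h, zPar]) ?_⟩
  · intro m hm
    rw [h]
    simp only [zPar]
    split_ifs <;> simp_all
  · intro m hm
    rw [h]
    simp only [zPar]
    split_ifs <;> simp_all
  · intro m l hm hl
    rw [h]
    simp only [zPar]
    split_ifs <;> simp_all <;> omega

end Display

end ParentMap

/-! ### The three cost functions. -/

/-- The cost of a tree `Z_s` at the triangle. -/
noncomputable def zCharge (s : ℝ) : ℝ := 729 / 64 + 16 + tail (s - 3)

/-- The cost of a star with `s` vertices hanging at the triangle by a pendant vertex. -/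
noncomputable def leafCharge (s : ℝ) : ℝ := 729 / 64 + (edgeWeight (s - 1) 3 + 1 + tail (s - 2))

/-- The cost of a star with `s` vertices whose centre lies on the triangle. -/
noncomputable def centerCharge (s : ℝ) : ℝ :=
  2 * edgeWeight 3 (s + 1) - 729 / 64 + (2 - 2 / s ^ 2 - 1 / s ^ 3)

/-- Strict convexity of `tail`: after dividing by the common step, the drop from `p` to `q` and the
drop from `r` to `t` are compared term by term. -/
lemma tail_add_tail_lt {p q r t : ℝ} (hp : 0 < p) (hpq : p < q) (hqr : q ≤ r)
    (h : p + t = q + r) : tail q + tail r < tail p + tail t := by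
  have ht : t = r + (q - p) := by linarith
  have hd : ∀ x y : ℝ, 0 < x → 0 < y →
      tail x - tail y = (y - x) * (3 / (x * y) + 1 / (x * y ^ 2) + 1 / (x ^ 2 * y)) := by
    intro x y hx hy
    unfold tail
    field_simp
    ring
  have hq : 0 < q := by linarith
  have hr : 0 < r := by linarith
  have ht0 : 0 < t := by linarith
  have hpr : p < r := by linarith
  have hqt : q < t := by linarith
  have h1 := hd p q hp hq
  have h2 := hd r t hr ht0
  have h3 : 3 / (r * t) < 3 / (p * q) := by gcongr
  have h4 : 1 / (r * t ^ 2) ≤ 1 / (p * q ^ 2) := by gcongr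
  have h5 : 1 / (r ^ 2 * t) ≤ 1 / (p ^ 2 * q) := by gcongr
  have h6 : t - r = q - p := by linarith
  rw [h6] at h2
  have h7 := mul_lt_mul_of_pos_left (add_lt_add_of_lt_of_le (add_lt_add_of_lt_of_le h3 h4) h5)
    (sub_pos.2 hpq)
  linarith

/-- Convexity favours balanced sizes; its strictness gives the second half, needed for uniqueness.
-/
lemma zCharge_add_balanced {s t : ℕ} (hs : 4 ≤ s) (hst : s ≤ t) :
    zCharge ((s + t) / 2 : ℕ) + zCharge ((s + t + 1) / 2 : ℕ) ≤ zCharge s + zCharge t ∧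
      (zCharge s + zCharge t ≤ zCharge ((s + t) / 2 : ℕ) + zCharge ((s + t + 1) / 2 : ℕ) →
        s = (s + t) / 2 ∧ t = (s + t + 1) / 2) := by
  by_cases h : s = (s + t) / 2
  · have h' : t = (s + t + 1) / 2 := by omega
    rw [← h, ← h']
    exact ⟨le_rfl, fun _ => ⟨rfl, rfl⟩⟩
  · have hs' : (4 : ℝ) ≤ s := by exact_mod_cast hs
    have h1 : (s : ℝ) < ((s + t) / 2 : ℕ) := by exact_mod_cast (by omega : s < (s + t) / 2)
    have h2 : (((s + t) / 2 : ℕ) : ℝ) ≤ ((s + t + 1) / 2 : ℕ) := by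
      exact_mod_cast (by omega : (s + t) / 2 ≤ (s + t + 1) / 2)
    have h3 : (s : ℝ) + t = ((s + t) / 2 : ℕ) + ((s + t + 1) / 2 : ℕ) := by
      exact_mod_cast (by omega : s + t = (s + t) / 2 + (s + t + 1) / 2)
    have := tail_add_tail_lt (p := s - 3) (q := ((s + t) / 2 : ℕ) - 3)
      (r := ((s + t + 1) / 2 : ℕ) - 3) (t := t - 3) (by linarith) (by linarith) (by linarith)
      (by linarith)
    unfold zCharge
    exact ⟨by linarith, fun hle => by linarith⟩

lemma zCharge_lt {s : ℝ} (hs : 3 < s) : 729 / 64 + 16 < zCharge s := by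
  unfold zCharge
  have := tail_pos (x := s - 3) (by linarith)
  linarith

lemma zCharge_anti {s t : ℝ} (hs : 3 < s) (h : s ≤ t) : zCharge t ≤ zCharge s := by
  unfold zCharge
  have := tail_anti (x := s - 3) (y := t - 3) (by linarith) (by linarith)
  linarith

lemma centerCharge_mono {s t : ℝ} (hs : 1 ≤ s) (h : s ≤ t) : centerCharge s ≤ centerCharge t := by
  unfold centerCharge
  have h1 := edgeWeight_mono (a := 3) (a' := 3) (b := s + 1) (b' := t + 1) (by norm_num) le_rfl
    (by linarith) (by linarith)
  have h2 : 2 / t ^ 2 ≤ 2 / s ^ 2 := by gcongr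
  have h3 : 1 / t ^ 3 ≤ 1 / s ^ 3 := by gcongr
  linarith

/-! ### Charges of cycle vertices and reduction to a triangle. -/

namespace ParentMap

variable {V : Type*} [Fintype V] {φ : V → V} {u v w c : V}

/-- The cost of a cycle vertex together with the tree hanging at it. -/
noncomputable def charge (φ : V → V) (v : V) : ℝ :=
  2 * edgeWeight 3 (deg φ v) - 729 / 64 + coreExcess φ v

lemma charge_of_deg_eq_three (hd : deg φ v = 3) : charge φ v = 729 / 64 + coreExcess φ v := by
  rw [charge, hd, Nat.cast_ofNat, edgeWeight_three_three]; ring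

lemma charge_of_isZTreeAt (hv : v ∈ core φ) (h : IsZTreeAt φ v) :
    charge φ v = zCharge (hang φ v).card := by
  obtain ⟨h1, h2⟩ := coreExcess_of_isZTreeAt hv h
  rw [charge_of_deg_eq_three h2, h1, zCharge]; ring

lemma charge_of_isLeafStarAt (hv : v ∈ core φ) (h : IsLeafStarAt φ v) :
    charge φ v = leafCharge (hang φ v).card := by
  obtain ⟨h1, h2⟩ := coreExcess_of_isLeafStarAt hv h
  rw [charge_of_deg_eq_three h2, h1, leafCharge]

lemma charge_of_isCenterStarAt (hv : v ∈ core φ) (h : IsCenterStarAt φ v) :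
    charge φ v = centerCharge (hang φ v).card := by
  obtain ⟨h1, h2⟩ := coreExcess_of_isCenterStarAt hv h
  rw [charge, h1, h2, centerCharge]; push_cast; ring

lemma charge_of_four_le_deg (hd : 4 ≤ deg φ v) (h : ¬ IsCenterStarAt φ v) :
    29.2 < charge φ v := by
  have h1 := coreExcess_of_four_le_deg hd h
  have h2 := edgeWeight_mono (a := 3) (a' := 3) (b := 4) (b' := deg φ v) (by norm_num) le_rfl
    (by norm_num) (by exact_mod_cast hd)
  rw [edgeWeight_three_four] at h2
  unfold charge
  norm_num at *
  linarith

/-- From size 6 on, the star attached by a leaf pays at least 125/8 on its connecting edge. Its loss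
of 125/8 + 1 - 16 = 0.625 against `Z_s` outweighs the tail difference, which is at most 0.6. -/
lemma charge_of_six_le (hv : v ∈ core φ) (hd : deg φ v = 3) (hs : 6 ≤ (hang φ v).card) :
    zCharge (hang φ v).card ≤ charge φ v ∧
      (charge φ v ≤ zCharge (hang φ v).card → IsZTreeAt φ v) := by
  have hs' : (6 : ℝ) ≤ (hang φ v).card := by exact_mod_cast hs
  rw [charge_of_deg_eq_three hd]
  rcases coreExcess_of_deg_eq_three hv hd (by omega) with ⟨-, h⟩ | ⟨hz, h⟩ | h
  · have h1 := edgeWeight_mono (a := 5) (a' := (hang φ v).card - 1) (b := 3) (b' := 3) (by norm_num)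
      (by linarith) (by norm_num) le_rfl
    have h2 : edgeWeight 5 3 = 125 / 8 := by unfold edgeWeight; norm_num
    rw [h2] at h1
    have h3 : tail ((hang φ v).card - 3) ≤ tail ((hang φ v).card - 2) + 0.6 := by
      rcases (by omega : (hang φ v).card = 6 ∨ 7 ≤ (hang φ v).card) with h6 | h7
      · rw [h6]; norm_num [tail]
      · have h7' : (7 : ℝ) ≤ (hang φ v).card := by exact_mod_cast h7
        set x : ℝ := ((hang φ v).card : ℝ) - 3 with hx
        have hx4 : 4 ≤ x := by linarith
        have he : ((hang φ v).card : ℝ) - 2 = x + 1 := by rw [hx]; ring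
        rw [he]
        have e1 : tail x - tail (x + 1) = 3 / (x * (x + 1)) + (2 * x + 1) / (x * (x + 1)) ^ 2 := by
          unfold tail
          field_simp
          ring
        have e2 : 3 / (x * (x + 1)) ≤ 3 / 20 := by
          gcongr; nlinarith
        have e3 : (2 * x + 1) / (x * (x + 1)) ^ 2 ≤ 9 / 400 := by
          rw [div_le_div_iff₀ (by positivity) (by norm_num)]
          nlinarith [sq_nonneg (x - 4), mul_nonneg (sub_nonneg.2 hx4) (sub_nonneg.2 hx4),
            pow_nonneg (sub_nonneg.2 hx4) 3, pow_nonneg (sub_nonneg.2 hx4) 4]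
        norm_num
        linarith
    unfold zCharge
    norm_num at h3
    exact ⟨by linarith, fun hle => by linarith⟩
  · rw [h, zCharge]
    exact ⟨by linarith, fun _ => hz⟩
  · rw [zCharge]
    exact ⟨by linarith, fun hle => by linarith⟩

lemma leafCharge_four : leafCharge 4 = 729 / 64 + (729 / 64 + 1 + 7 / 4) := by
  norm_num [leafCharge, edgeWeight, tail]

lemma leafCharge_five : leafCharge 5 = 729 / 64 + (1728 / 125 + 1 + 10 / 9) := by
  norm_num [leafCharge, edgeWeight, tail]

/-- For sizes 4 and 5 the comparison is reversed: the connecting edge has weight w(3, 3) or w(4, 3)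
only, and the star attached by a leaf beats `Z_s`. -/
lemma charge_of_card_le_five (hv : v ∈ core φ) (hd : deg φ v = 3)
    (hs : (hang φ v).card = 4 ∨ (hang φ v).card = 5) :
    leafCharge (hang φ v).card ≤ charge φ v ∧
      (charge φ v ≤ leafCharge (hang φ v).card → IsLeafStarAt φ v) := by
  rw [charge_of_deg_eq_three hd]
  have key : leafCharge (hang φ v).card < 729 / 64 + 16 + tail ((hang φ v).card - 3) := by
    rcases hs with h | h <;> rw [h]
    · rw [Nat.cast_ofNat, leafCharge_four]; norm_num [tail]
    · rw [Nat.cast_ofNat, leafCharge_five]; norm_num [tail]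
  rcases coreExcess_of_deg_eq_three hv hd (by omega) with ⟨hl, h⟩ | ⟨-, h⟩ | h
  · rw [h, leafCharge]
    exact ⟨le_rfl, fun _ => hl⟩
  · exact ⟨by linarith, fun hle => by linarith⟩
  · exact ⟨by linarith, fun hle => by linarith⟩

/-- The contribution of a cycle vertex is either large or comes from a vertex of large degree. -/
lemma coreExcess_cases {k : ℕ} (hk : 4 ≤ k) (hv : v ∈ core φ) (hs : k ≤ (hang φ v).card) :
    13 ≤ coreExcess φ v ∨
      (1.859 ≤ coreExcess φ v ∧ k + 1 ≤ deg φ v ∧ IsCenterStarAt φ v) := by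
  by_cases hc : IsCenterStarAt φ v
  · right
    obtain ⟨h1, h2⟩ := coreExcess_of_isCenterStarAt hv hc
    refine ⟨?_, by omega, hc⟩
    -- The bound 1.859 rounds down 2 - 2/4² - 1/4³, the value at size 4.
    have hs' : (4 : ℝ) ≤ (hang φ v).card := by exact_mod_cast hk.trans hs
    have h3 : 2 / ((hang φ v).card : ℝ) ^ 2 ≤ 2 / 4 ^ 2 := by gcongr
    have h4 : 1 / ((hang φ v).card : ℝ) ^ 3 ≤ 1 / 4 ^ 3 := by gcongr
    rw [h1]
    norm_num at h3 h4 ⊢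
    linarith
  · left
    have h3 := three_le_deg hv (by omega)
    by_cases hd : deg φ v = 3
    · have hs' : (4 : ℝ) ≤ (hang φ v).card := by exact_mod_cast hk.trans hs
      have t2 := tail_pos (x := (hang φ v).card - 2) (by linarith)
      have t3 := tail_pos (x := (hang φ v).card - 3) (by linarith)
      rcases coreExcess_of_deg_eq_three hv hd (by omega) with ⟨-, h⟩ | ⟨-, h⟩ | h
      · have h1 := edgeWeight_mono (a := 3) (a' := (hang φ v).card - 1) (b := 3) (b' := 3)
          (by norm_num) (by linarith) (by norm_num) le_rfl
        rw [edgeWeight_three_three] at h1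
        rcases (by omega : (hang φ v).card = 4 ∨ 5 ≤ (hang φ v).card) with h4 | h5
        · rw [h, h4, Nat.cast_ofNat]; norm_num [edgeWeight, tail]
        · have h5' : (5 : ℝ) ≤ (hang φ v).card := by exact_mod_cast h5
          have h1 := edgeWeight_mono (a := 4) (a' := (hang φ v).card - 1) (b := 3) (b' := 3)
            (by norm_num) (by linarith) (by norm_num) le_rfl
          rw [edgeWeight_comm 4 3, edgeWeight_three_four] at h1
          linarith
      · linarith
      · linarith
    · exact coreExcess_of_four_le_deg (by omega) hc

/-- The constant rounds down 21.71875, the charge of a centred star with four vertices. -/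
lemma charge_lower_bound {k : ℕ} (hk : 4 ≤ k) (hv : v ∈ core φ) (hs : k ≤ (hang φ v).card) :
    21.7 ≤ charge φ v := by
  have hd := three_le_deg hv (by omega)
  have hd' : (3 : ℝ) ≤ deg φ v := by exact_mod_cast hd
  unfold charge
  rcases coreExcess_cases hk hv hs with h | ⟨h, hdk, -⟩
  · have h1 := edgeWeight_mono (a := 3) (a' := 3) (b := 3) (by norm_num) le_rfl (by norm_num) hd'
    rw [edgeWeight_three_three] at h1
    norm_num
    linarith
  · have h1 := edgeWeight_mono (a := 3) (a' := 3) (b := 5) (b' := deg φ v) (by norm_num) le_rfl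
      (by norm_num) (by exact_mod_cast (by omega : 5 ≤ deg φ v))
    have h2 : edgeWeight 3 5 = 125 / 8 := by unfold edgeWeight; norm_num
    rw [h2] at h1
    norm_num at h ⊢
    linarith

/-- By supermodularity a cycle edge with end degrees a and b weighs at least w(3, a) + w(3, b) -
w(3, 3). Every cycle vertex lies on two cycle edges, whence the factor 2 in `charge`. -/
lemma sum_charge_le {G : SimpleGraph V} (h : G.IsOrientedBy φ)
    (hs : ∀ v ∈ core φ, 2 ≤ (hang φ v).card) :
    Fintype.card V + ∑ v ∈ core φ, charge φ v ≤ augmentedZagrebIndex G := by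
  rw [h.augmentedZagrebIndex_eq_sum_core]
  have h1 : ∑ v ∈ core φ, charge φ v = ∑ v ∈ core φ, (edgeWeight 3 (deg φ v) +
      edgeWeight 3 (deg φ (φ v)) - 729 / 64 + coreExcess φ v) := by
    have := sum_core_comp φ fun v => edgeWeight 3 (deg φ v)
    simp only [charge, Finset.sum_add_distrib, Finset.sum_sub_distrib, ← Finset.mul_sum]
    linarith
  rw [h1]
  gcongr with v hv
  have h3 : (3 : ℝ) ≤ deg φ v := by exact_mod_cast three_le_deg hv (hs v hv)
  have h3' : (3 : ℝ) ≤ deg φ (φ v) := by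
    exact_mod_cast three_le_deg (map_mem_core hv) (hs _ (map_mem_core hv))
  have := edgeWeight_add_le h3 h3'
  rw [edgeWeight_three_three] at this
  linarith

/-- An upper bound for the minimum, without the number of vertices. -/
noncomputable def threshold (k : ℕ) : ℝ := if k = 4 then 76 else 84.7

lemma edgeWeight_sum_mono {x y z a b c : ℝ} (hx : 3 ≤ x) (hy : 3 ≤ y) (hz : 3 ≤ z)
    (ha : x ≤ a) (hb : y ≤ b) (hc : z ≤ c) :
    edgeWeight x y + edgeWeight y z + edgeWeight x z ≤
      edgeWeight a b + edgeWeight b c + edgeWeight a c := by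
  have h1 := edgeWeight_mono (a := x) (b := y) (by linarith) ha (by linarith) hb
  have h2 := edgeWeight_mono (a := y) (b := z) (by linarith) hb (by linarith) hc
  have h3 := edgeWeight_mono (a := x) (b := z) (by linarith) ha (by linarith) hc
  linarith

/-- Two triangle vertices of degree at least four are too expensive. -/
lemma threshold_le_of_four_le_deg {k : ℕ} (hk : 4 ≤ k) {G : SimpleGraph V}
    (h : G.IsOrientedBy φ) (hs : ∀ v ∈ core φ, k ≤ (hang φ v).card) {u : Fin 3 → V}
    (hu : IsTriangle φ u) (h0 : 4 ≤ deg φ (u 0)) (h1 : 4 ≤ deg φ (u 1)) :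
    Fintype.card V + threshold k ≤ augmentedZagrebIndex G := by
  rw [hu.augmentedZagrebIndex_eq h]
  have h2 := three_le_deg (hu.mem_core 2) (by have := hs _ (hu.mem_core 2); omega)
  have h0' : (4 : ℝ) ≤ deg φ (u 0) := by exact_mod_cast h0
  have h1' : (4 : ℝ) ≤ deg φ (u 1) := by exact_mod_cast h1
  have h2' : (3 : ℝ) ≤ deg φ (u 2) := by exact_mod_cast h2
  have c0 := coreExcess_cases hk (hu.mem_core 0) (hs _ (hu.mem_core 0))
  have c1 := coreExcess_cases hk (hu.mem_core 1) (hs _ (hu.mem_core 1))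
  have c2 := coreExcess_cases hk (hu.mem_core 2) (hs _ (hu.mem_core 2))
  have big : ∀ i, k + 1 ≤ deg φ (u i) → (5 : ℝ) ≤ deg φ (u i) ∧ (k ≠ 4 → (6 : ℝ) ≤ deg φ (u i)) :=
    fun i hi => ⟨by exact_mod_cast (by omega : 5 ≤ deg φ (u i)),
      fun h4 => by exact_mod_cast (by omega : 6 ≤ deg φ (u i))⟩
  unfold threshold
  set x : ℝ := (deg φ (u 0) : ℝ)
  set y : ℝ := (deg φ (u 1) : ℝ)
  set z : ℝ := (deg φ (u 2) : ℝ)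
  have bound : ∀ a b c : ℝ, 3 ≤ a → 3 ≤ b → 3 ≤ c → a ≤ x → b ≤ y → c ≤ z →
      edgeWeight a b + edgeWeight b c + edgeWeight a c ≤
        edgeWeight x y + edgeWeight y z + edgeWeight x z :=
    fun a b c ha hb hc hax hby hcz => edgeWeight_sum_mono ha hb hc hax hby hcz
  -- Eight cases, according to which roots carry centred stars, with the smallest admissible
  -- degrees. The tightest totals are about 78.5 for k = 4, from degrees 5, 5, 3, and about 85.6
  -- otherwise, from degrees 4, 4, 3.
  split_ifs with h4
  · rcases c0 with c0 | ⟨c0, b0, -⟩ <;> rcases c1 with c1 | ⟨c1, b1, -⟩ <;>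
      rcases c2 with c2 | ⟨c2, b2, -⟩
    · have := bound 4 4 3 (by norm_num) (by norm_num) le_rfl h0' h1' h2'
      norm_num [edgeWeight] at this c0 c1 c2 ⊢; linarith
    · have := bound 4 4 5 (by norm_num) (by norm_num) (by norm_num) h0' h1' (big 2 b2).1
      norm_num [edgeWeight] at this c0 c1 c2 ⊢; linarith
    · have := bound 4 5 3 (by norm_num) (by norm_num) le_rfl h0' (big 1 b1).1 h2'
      norm_num [edgeWeight] at this c0 c1 c2 ⊢; linarith
    · have := bound 4 5 5 (by norm_num) (by norm_num) (by norm_num) h0' (big 1 b1).1 (big 2 b2).1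
      norm_num [edgeWeight] at this c0 c1 c2 ⊢; linarith
    · have := bound 5 4 3 (by norm_num) (by norm_num) le_rfl (big 0 b0).1 h1' h2'
      norm_num [edgeWeight] at this c0 c1 c2 ⊢; linarith
    · have := bound 5 4 5 (by norm_num) (by norm_num) (by norm_num) (big 0 b0).1 h1' (big 2 b2).1
      norm_num [edgeWeight] at this c0 c1 c2 ⊢; linarith
    · have := bound 5 5 3 (by norm_num) (by norm_num) le_rfl (big 0 b0).1 (big 1 b1).1 h2'
      norm_num [edgeWeight] at this c0 c1 c2 ⊢; linarith
    · have := bound 5 5 5 (by norm_num) (by norm_num) (by norm_num) (big 0 b0).1 (big 1 b1).1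
        (big 2 b2).1
      norm_num [edgeWeight] at this c0 c1 c2 ⊢; linarith
  · rcases c0 with c0 | ⟨c0, b0, -⟩ <;> rcases c1 with c1 | ⟨c1, b1, -⟩ <;>
      rcases c2 with c2 | ⟨c2, b2, -⟩
    · have := bound 4 4 3 (by norm_num) (by norm_num) le_rfl h0' h1' h2'
      norm_num [edgeWeight] at this c0 c1 c2 ⊢; linarith
    · have := bound 4 4 6 (by norm_num) (by norm_num) (by norm_num) h0' h1' ((big 2 b2).2 h4)
      norm_num [edgeWeight] at this c0 c1 c2 ⊢; linarith
    · have := bound 4 6 3 (by norm_num) (by norm_num) le_rfl h0' ((big 1 b1).2 h4) h2'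
      norm_num [edgeWeight] at this c0 c1 c2 ⊢; linarith
    · have := bound 4 6 6 (by norm_num) (by norm_num) (by norm_num) h0' ((big 1 b1).2 h4)
        ((big 2 b2).2 h4)
      norm_num [edgeWeight] at this c0 c1 c2 ⊢; linarith
    · have := bound 6 4 3 (by norm_num) (by norm_num) le_rfl ((big 0 b0).2 h4) h1' h2'
      norm_num [edgeWeight] at this c0 c1 c2 ⊢; linarith
    · have := bound 6 4 6 (by norm_num) (by norm_num) (by norm_num) ((big 0 b0).2 h4) h1'
        ((big 2 b2).2 h4)
      norm_num [edgeWeight] at this c0 c1 c2 ⊢; linarith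
    · have := bound 6 6 3 (by norm_num) (by norm_num) le_rfl ((big 0 b0).2 h4) ((big 1 b1).2 h4) h2'
      norm_num [edgeWeight] at this c0 c1 c2 ⊢; linarith
    · have := bound 6 6 6 (by norm_num) (by norm_num) (by norm_num) ((big 0 b0).2 h4)
        ((big 1 b1).2 h4) ((big 2 b2).2 h4)
      norm_num [edgeWeight] at this c0 c1 c2 ⊢; linarith

/-- Every triangle edge then has an end of degree 3, where the supermodular inequality is an
equality; so the charge bound is exact. -/
lemma IsTriangle.augmentedZagrebIndex_eq_charge {G : SimpleGraph V} (h : G.IsOrientedBy φ)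
    {u : Fin 3 → V} (hu : IsTriangle φ u) (h1 : deg φ (u 1) = 3) (h2 : deg φ (u 2) = 3) :
    augmentedZagrebIndex G =
      Fintype.card V + (charge φ (u 0) + charge φ (u 1) + charge φ (u 2)) := by
  rw [hu.augmentedZagrebIndex_eq h, charge_of_deg_eq_three h1, charge_of_deg_eq_three h2, charge,
    h1, h2, Nat.cast_ofNat, edgeWeight_comm _ 3, edgeWeight_three_three]
  ring

/-- A graph of small index has a triangle, with at most one vertex of degree at least four. -/
lemma exists_triangle_of_lt_threshold {k : ℕ} (hk : 4 ≤ k) {G : SimpleGraph V}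
    (h : G.IsOrientedBy φ) (hs : ∀ v ∈ core φ, k ≤ (hang φ v).card)
    (hlt : augmentedZagrebIndex G < Fintype.card V + threshold k) :
    ∃ u, IsTriangle φ u ∧ deg φ (u 1) = 3 ∧ deg φ (u 2) = 3 := by
  have hcard : (core φ).card = 3 := by
    by_contra hne
    have h4 : 4 ≤ (core φ).card := by have := h.three_le_card_core; omega
    have h4' : (4 : ℝ) ≤ (core φ).card := by exact_mod_cast h4
    have h1 := sum_charge_le h fun v hv => by have := hs v hv; omega
    have h2 : (core φ).card • (21.7 : ℝ) ≤ ∑ v ∈ core φ, charge φ v :=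
      Finset.card_nsmul_le_sum _ _ _ fun v hv => charge_lower_bound hk hv (hs v hv)
    rw [nsmul_eq_mul] at h2
    -- Four charges of 21.7 amount to 86.8.
    have h3 : threshold k ≤ 84.7 := by unfold threshold; split_ifs <;> norm_num
    norm_num at h2 h3
    linarith
  obtain ⟨u, hu⟩ := exists_isTriangle hcard
  have key : ∀ σ : Equiv.Perm (Fin 3), 4 ≤ deg φ (u (σ 0)) → deg φ (u (σ 1)) = 3 := by
    intro σ h0
    have h3 := three_le_deg (hu.mem_core (σ 1)) (by have := hs _ (hu.mem_core (σ 1)); omega)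
    by_contra hne
    exact absurd (threshold_le_of_four_le_deg hk h hs (hu.comp σ) h0
      (show 4 ≤ deg φ (u (σ 1)) by omega)) (not_le.2 hlt)
  have h3 : ∀ i, 3 ≤ deg φ (u i) := fun i =>
    three_le_deg (hu.mem_core i) (by have := hs _ (hu.mem_core i); omega)
  by_cases d1 : deg φ (u 1) = 3
  · by_cases d2 : deg φ (u 2) = 3
    · exact ⟨u, hu, d1, d2⟩
    · refine ⟨u ∘ Equiv.swap 0 2, hu.comp _, d1, ?_⟩
      have h4 : 4 ≤ deg φ (u 2) := by have := h3 2; omega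
      exact key (Equiv.swap 0 2 * Equiv.swap 1 2) h4
  · refine ⟨u ∘ Equiv.swap 0 1, hu.comp _, ?_, ?_⟩
    · exact key (Equiv.swap 0 1) (by have := h3 1; simp; omega)
    · exact key (Equiv.swap 0 1 * Equiv.swap 1 2) (by
        have := h3 1
        have e : (Equiv.swap 0 1 * Equiv.swap 1 2 : Equiv.Perm (Fin 3)) 0 = 1 := by decide
        rw [e]; omega)

end ParentMap

/-! ### Identification of the minimiser in the three ranges of `k`. -/

namespace ParentMap

variable {V : Type*} [Fintype V] {φ : V → V} {u v w c : V}

/-- The hanging trees of `φ` have at least `k` vertices, and one has exactly `k`. -/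
def HasMinHang (φ : V → V) (k : ℕ) : Prop :=
  (∀ v ∈ core φ, k ≤ (hang φ v).card) ∧ ∃ v ∈ core φ, (hang φ v).card = k

lemma IsTriangle.sum_card {u : Fin 3 → V} (hu : IsTriangle φ u) :
    (hang φ (u 0)).card + (hang φ (u 1)).card + (hang φ (u 2)).card = Fintype.card V := by
  rw [← sum_card_hang φ, hu.sum_core]

/-- A cycle vertex whose tree has at least six vertices, and is not a star with six vertices
centred there, costs at least as much as a `Z_s`. -/
lemma zCharge_le_charge (hv : v ∈ core φ)
    (h6 : 6 ≤ (hang φ v).card) (h : (hang φ v).card = 6 → ¬ IsCenterStarAt φ v) :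
    zCharge (hang φ v).card ≤ charge φ v ∧
      (charge φ v ≤ zCharge (hang φ v).card → IsZTreeAt φ v) := by
  by_cases hd : deg φ v = 3
  · exact charge_of_six_le hv hd h6
  · have hd4 : 4 ≤ deg φ v := by have := three_le_deg hv (by omega); omega
    have hs' : (6 : ℝ) ≤ (hang φ v).card := by exact_mod_cast h6
    have hlt : zCharge (hang φ v).card < charge φ v := by
      by_cases hc : IsCenterStarAt φ v
      · have h7 : 7 ≤ (hang φ v).card := by
          rcases Nat.lt_or_ge 6 (hang φ v).card with h7 | h7
          · exact h7
          · exact absurd hc (h (le_antisymm h7 h6))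
        have h7' : (7 : ℝ) ≤ (hang φ v).card := by exact_mod_cast h7
        rw [charge_of_isCenterStarAt hv hc]
        have h1 := zCharge_anti (s := 7) (by norm_num) h7'
        have h2 := centerCharge_mono (s := 7) (by norm_num) h7'
        -- Size 7 is where the centred star stops being cheaper. Its charge increases with the size
        -- while that of `Z_s` decreases, so one comparison suffices.
        have h3 : zCharge 7 < centerCharge 7 := by
          norm_num [zCharge, tail, centerCharge, edgeWeight]
        linarith
      · have h1 := zCharge_anti (s := 6) (by norm_num) hs'
        have h2 := charge_of_four_le_deg hd4 hc
        have h3 : zCharge 6 ≤ 29 := by norm_num [zCharge, tail]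
        norm_num at h2
        linarith
    exact ⟨hlt.le, fun hle => absurd hle (not_le.2 hlt)⟩

/-- Two trees of type `Z` of balanced sizes are the cheapest. -/
lemma exists_balanced {u : Fin 3 → V} (hu : IsTriangle φ u) {m : ℕ} {C : ℝ}
    (hm : (hang φ (u 1)).card + (hang φ (u 2)).card = m)
    (h1 : 4 ≤ (hang φ (u 1)).card) (h2 : 4 ≤ (hang φ (u 2)).card)
    (hz : ∀ i, i ≠ 0 → zCharge (hang φ (u i)).card ≤ charge φ (u i) ∧
      (charge φ (u i) ≤ zCharge (hang φ (u i)).card → IsZTreeAt φ (u i)))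
    (h0 : C ≤ charge φ (u 0))
    (hle : charge φ (u 0) + charge φ (u 1) + charge φ (u 2) ≤
      C + zCharge (m / 2 : ℕ) + zCharge ((m + 1) / 2 : ℕ)) :
    ∃ u', IsTriangle φ u' ∧ u' 0 = u 0 ∧ charge φ (u 0) ≤ C ∧
      (hang φ (u' 1)).card = m / 2 ∧ (hang φ (u' 2)).card = (m + 1) / 2 ∧
      IsZTreeAt φ (u' 1) ∧ IsZTreeAt φ (u' 2) := by
  wlog h12 : (hang φ (u 1)).card ≤ (hang φ (u 2)).card generalizing u
  · obtain ⟨u', h⟩ := this (u := u ∘ Equiv.swap 1 2) (hu.comp _)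
      (by simpa [add_comm] using hm) (by simpa using h2) (by simpa using h1)
      (fun i hi => hz _ (by revert i; decide)) (by simpa [Equiv.swap_apply_of_ne_of_ne] using h0)
      (by simp [Equiv.swap_apply_of_ne_of_ne]; linarith) (by simp; omega)
    exact ⟨u', by simpa [Equiv.swap_apply_of_ne_of_ne] using h⟩
  obtain ⟨hb, hb'⟩ := zCharge_add_balanced h1 h12
  rw [hm] at hb hb'
  obtain ⟨a1, b1⟩ := hz 1 (by decide)
  obtain ⟨a2, b2⟩ := hz 2 (by decide)
  -- The lower bounds on the charges turn `hle` into the reverse of the convexity inequality, which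
  -- fixes the sizes; then all bounds are attained and the trees are of type `Z`.
  obtain ⟨e1, e2⟩ := hb' (by linarith)
  exact ⟨u, hu, rfl, by linarith, e1, e2, b1 (by linarith), b2 (by linarith)⟩

lemma exists_zTree_zTree_zTree {n k : ℕ} (hV : Fintype.card V = n) (hn : 3 * k + 3 ≤ n)
    (hk : 7 ≤ k) {G : SimpleGraph V} (h : G.IsOrientedBy φ) (hmin : HasMinHang φ k)
    (hle : augmentedZagrebIndex G ≤
      n + (zCharge k + zCharge ((n - k) / 2 : ℕ) + zCharge ((n - k + 1) / 2 : ℕ))) :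
    ∃ u, IsTriangle φ u ∧ (hang φ (u 0)).card = k ∧ (hang φ (u 1)).card = (n - k) / 2 ∧
      (hang φ (u 2)).card = (n - k + 1) / 2 ∧ ∀ i, IsZTreeAt φ (u i) := by
  obtain ⟨hs, v, hv, hvk⟩ := hmin
  have hk7 : (7 : ℝ) ≤ k := by exact_mod_cast hk
  have h8 : (8 : ℝ) ≤ ((n - k) / 2 : ℕ) := by exact_mod_cast (by omega : 8 ≤ (n - k) / 2)
  have h8' : (8 : ℝ) ≤ ((n - k + 1) / 2 : ℕ) := by exact_mod_cast (by omega : 8 ≤ (n - k + 1) / 2)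
  have z1 := zCharge_anti (s := 7) (by norm_num) hk7
  have z2 := zCharge_anti (s := 8) (by norm_num) h8
  have z3 := zCharge_anti (s := 8) (by norm_num) h8'
  -- The sizes 7, 8, 8 are the least that `7 ≤ k` and `3 * k + 3 ≤ n` allow.
  have z7 : zCharge 7 + zCharge 8 + zCharge 8 < 84.7 := by norm_num [zCharge, tail]
  obtain ⟨u, hu, d1, d2⟩ := exists_triangle_of_lt_threshold (by omega) h hs (by
    rw [threshold, if_neg (by omega), hV]; linarith)
  have haz := hu.augmentedZagrebIndex_eq_charge h d1 d2
  rw [hV] at haz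
  obtain ⟨i, rfl⟩ := (hu.mem_core_iff v).1 hv
  set σ : Equiv.Perm (Fin 3) := Equiv.swap 0 i
  have hsum : charge φ (u (σ 0)) + charge φ (u (σ 1)) + charge φ (u (σ 2)) =
      charge φ (u 0) + charge φ (u 1) + charge φ (u 2) := by
    have := Equiv.sum_comp σ fun i => charge φ (u i)
    rwa [Fin.sum_univ_three, Fin.sum_univ_three] at this
  have h0 : u (σ 0) = u i := by simp [σ]
  have hz : ∀ j, zCharge (hang φ (u j)).card ≤ charge φ (u j) ∧
      (charge φ (u j) ≤ zCharge (hang φ (u j)).card → IsZTreeAt φ (u j)) := fun j => by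
    have := hs _ (hu.mem_core j)
    exact zCharge_le_charge (hu.mem_core j) (by omega) (by omega)
  have hc := (hu.comp σ).sum_card
  simp only [comp_apply, h0, hvk, hV] at hc
  obtain ⟨u', hu', e0, c0, e1, e2, z1, z2⟩ := exists_balanced (hu.comp σ) (m := n - k)
    (C := zCharge k) (by simp only [comp_apply]; omega)
    (by have := hs _ (hu.mem_core (σ 1)); simp only [comp_apply]; omega)
    (by have := hs _ (hu.mem_core (σ 2)); simp only [comp_apply]; omega)
    (fun j _ => hz _) (by simp only [comp_apply, h0]; rw [← hvk]; exact (hz i).1)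
    (by simp only [comp_apply]; linarith)
  simp only [comp_apply, h0] at e0 c0
  refine ⟨u', hu', by rw [e0, hvk], e1, e2, fun j => ?_⟩
  fin_cases j
  · show IsZTreeAt φ (u' 0)
    rw [e0]
    exact (hz i).2 (by rw [hvk]; exact c0)
  · exact z1
  · exact z2

lemma exists_centerStar_zTree_zTree {n : ℕ} (hV : Fintype.card V = n) (hn : 21 ≤ n)
    {G : SimpleGraph V} (h : G.IsOrientedBy φ) (hmin : HasMinHang φ 6)
    (hle : augmentedZagrebIndex G ≤
      n + (centerCharge 6 + zCharge (n / 2 - 3 : ℕ) + zCharge ((n + 1) / 2 - 3 : ℕ))) :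
    ∃ u, IsTriangle φ u ∧ (hang φ (u 0)).card = 6 ∧ (hang φ (u 1)).card = n / 2 - 3 ∧
      (hang φ (u 2)).card = (n + 1) / 2 - 3 ∧ IsCenterStarAt φ (u 0) ∧ IsZTreeAt φ (u 1) ∧
      IsZTreeAt φ (u 2) := by
  obtain ⟨hs, v, hv, hvk⟩ := hmin
  have h7 : (7 : ℝ) ≤ (n / 2 - 3 : ℕ) := by exact_mod_cast (by omega : 7 ≤ n / 2 - 3)
  have h8 : (8 : ℝ) ≤ ((n + 1) / 2 - 3 : ℕ) := by exact_mod_cast (by omega : 8 ≤ (n + 1) / 2 - 3)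
  have z2 := zCharge_anti (s := 7) (by norm_num) h7
  have z3 := zCharge_anti (s := 8) (by norm_num) h8
  have z7 : centerCharge 6 + zCharge 7 + zCharge 8 < 83 := by
    norm_num [centerCharge, edgeWeight, zCharge, tail]
  obtain ⟨u, hu, d1, d2⟩ := exists_triangle_of_lt_threshold (by omega) h hs (by
    rw [threshold, if_neg (by omega), hV]; norm_num; linarith)
  have haz := hu.augmentedZagrebIndex_eq_charge h d1 d2
  rw [hV] at haz
  have hc := hu.sum_card
  rw [hV] at hc
  have hz : ∀ j, ((hang φ (u j)).card = 6 → ¬ IsCenterStarAt φ (u j)) →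
      zCharge (hang φ (u j)).card ≤ charge φ (u j) ∧
      (charge φ (u j) ≤ zCharge (hang φ (u j)).card → IsZTreeAt φ (u j)) := fun j hj => by
    have := hs _ (hu.mem_core j)
    exact zCharge_le_charge (hu.mem_core j) (by omega) hj
  have hnc : ∀ j, deg φ (u j) = 3 → ¬ IsCenterStarAt φ (u j) := fun j hd hcen => by
    have h1 := (coreExcess_of_isCenterStarAt (hu.mem_core j) hcen).2
    have := hs _ (hu.mem_core j)
    omega
  have hs0 := hs _ (hu.mem_core 0)
  have hs1 := hs _ (hu.mem_core 1)
  have hs2 := hs _ (hu.mem_core 2)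
  have gt : ∀ j, 729 / 64 + 16 < zCharge (hang φ (u j)).card := fun j =>
    zCharge_lt (by exact_mod_cast (by have := hs _ (hu.mem_core j); omega : 3 < (hang φ (u j)).card))
  have b1 := hz 1 fun _ => hnc 1 d1
  have b2 := hz 2 fun _ => hnc 2 d2
  have g0 := gt 0
  have g1 := gt 1
  have g2 := gt 2
  by_cases h0 : (hang φ (u 0)).card = 6 ∧ IsCenterStarAt φ (u 0)
  · obtain ⟨h06, h0c⟩ := h0
    have hcc := charge_of_isCenterStarAt (hu.mem_core 0) h0c
    rw [h06, Nat.cast_ofNat] at hcc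
    have en1 : n / 2 - 3 = (n - 6) / 2 := by omega
    have en2 : (n + 1) / 2 - 3 = (n - 6 + 1) / 2 := by omega
    rw [en1, en2] at hle ⊢
    obtain ⟨u', hu', e0, -, e1, e2, z1, z2⟩ := exists_balanced hu (m := n - 6)
      (C := centerCharge 6) (by omega) (by omega) (by omega)
      (fun j hj => by
        fin_cases j
        · exact absurd rfl hj
        · exact b1
        · exact b2) hcc.ge (by linarith)
    exact ⟨u', hu', by rw [e0, h06], e1, e2, by rw [e0]; exact h0c, z1, z2⟩
  · exfalso
    have b0 := hz 0 fun h6 hcen => h0 ⟨h6, hcen⟩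
    -- Without a centred star of size 6, every tree costs at least as much as `Z_s`. One has size 6,
    -- and 28.5 + 2 · (729/64 + 16) exceeds 83.
    have hz6 : (28.5 : ℝ) ≤ zCharge 6 := by norm_num [zCharge, tail]
    obtain ⟨i, rfl⟩ := (hu.mem_core_iff v).1 hv
    have hi : (28.5 : ℝ) ≤ zCharge (hang φ (u i)).card := by rw [hvk]; exact_mod_cast hz6
    norm_num at hi
    fin_cases i <;> simp only [Fin.zero_eta, Fin.mk_one, Fin.reduceFinMk] at hi <;> linarith

/-- For degree 3 the least charges are those of the attached stars at sizes 4 and 5, which increase,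
and more than 729/64 + 16 from size 6 on. Roots of larger degree cost more than 29.2. -/
lemma leafCharge_le_charge {k : ℕ} (hk : k = 4 ∨ k = 5) (hv : v ∈ core φ)
    (hs : k ≤ (hang φ v).card) (h : ¬ IsCenterStarAt φ v) : leafCharge k ≤ charge φ v := by
  have h4 := leafCharge_four
  have h5 := leafCharge_five
  have hlk : leafCharge k ≤ 729 / 64 + 16 := by
    rcases hk with rfl | rfl
    · rw [Nat.cast_ofNat, h4]; norm_num
    · rw [Nat.cast_ofNat, h5]; norm_num
  by_cases hd : deg φ v = 3
  · rcases (by omega : (hang φ v).card = 4 ∨ (hang φ v).card = 5 ∨ 6 ≤ (hang φ v).card) with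
      hc | hc | hc
    · have hb := (charge_of_card_le_five hv hd (Or.inl hc)).1
      have hk4 : k = 4 := by omega
      rwa [hc, ← hk4] at hb
    · have hb := (charge_of_card_le_five hv hd (Or.inr hc)).1
      rw [hc, Nat.cast_ofNat] at hb
      refine le_trans ?_ hb
      rcases hk with rfl | rfl
      · rw [Nat.cast_ofNat, h4, h5]; norm_num
      · rfl
    · have hb := (charge_of_six_le hv hd hc).1
      have := zCharge_lt (s := (hang φ v).card) (by exact_mod_cast (by omega : 3 < (hang φ v).card))
      linarith
  · have h3 := three_le_deg hv (by omega)
    have hb := charge_of_four_le_deg (by omega) h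
    norm_num at hb
    linarith

lemma exists_centerStar_leafStar_zTree {n k : ℕ} (hV : Fintype.card V = n) (hn : 3 * k + 3 ≤ n)
    (hk : k = 4 ∨ k = 5) {G : SimpleGraph V} (h : G.IsOrientedBy φ) (hmin : HasMinHang φ k)
    (hle : augmentedZagrebIndex G ≤
      n + (centerCharge k + leafCharge k + zCharge (n - 2 * k : ℕ))) :
    ∃ u, IsTriangle φ u ∧ (hang φ (u 0)).card = k ∧ (hang φ (u 1)).card = k ∧
      (hang φ (u 2)).card = n - 2 * k ∧ IsCenterStarAt φ (u 0) ∧ IsLeafStarAt φ (u 1) ∧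
      IsZTreeAt φ (u 2) := by
  obtain ⟨hs, v, hv, hvk⟩ := hmin
  have h4 := leafCharge_four
  have h5 := leafCharge_five
  have c4 : centerCharge 4 = 21.71875 := by norm_num [centerCharge, edgeWeight]
  have c5 : 24.52 ≤ centerCharge 5 ∧ centerCharge 5 ≤ 24.54 := by
    norm_num [centerCharge, edgeWeight]
  have c6 : 26.7 ≤ centerCharge 6 := by norm_num [centerCharge, edgeWeight]
  norm_num at c4 c5 c6
  have hz : zCharge (n - 2 * k : ℕ) ≤ 28.21 ∧ (k = 5 → zCharge (n - 2 * k : ℕ) ≤ 28.04) := by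
    have z7 : zCharge 7 ≤ 28.21 := by norm_num [zCharge, tail]
    have z8 : zCharge 8 ≤ 28.04 := by norm_num [zCharge, tail]
    refine ⟨(zCharge_anti (by norm_num) ?_).trans z7, fun h5 =>
      (zCharge_anti (by norm_num) ?_).trans z8⟩
    · exact_mod_cast (by omega : 7 ≤ n - 2 * k)
    · exact_mod_cast (by omega : 8 ≤ n - 2 * k)
  norm_num at hz
  have hopt : centerCharge k + leafCharge k + zCharge (n - 2 * k : ℕ) ≤
      if k = 4 then 75.461 else 79.91 := by
    rcases hk with rfl | rfl
    · rw [if_pos rfl, Nat.cast_ofNat, h4, c4]; norm_num; linarith [hz.1]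
    · rw [if_neg (by omega), Nat.cast_ofNat, h5]; norm_num; linarith [hz.2 rfl]
  obtain ⟨u, hu, d1, d2⟩ := exists_triangle_of_lt_threshold (by omega) h hs (by
    have ht : (if k = 4 then (75.461 : ℝ) else 79.91) < threshold k := by
      unfold threshold; split_ifs <;> norm_num
    rw [hV]; linarith)
  have haz := hu.augmentedZagrebIndex_eq_charge h d1 d2
  have hc := hu.sum_card
  rw [hV] at haz hc
  have hle' : charge φ (u 0) + charge φ (u 1) + charge φ (u 2) ≤
      centerCharge k + leafCharge k + zCharge (n - 2 * k : ℕ) := by linarith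
  have hle'' := hle'.trans hopt
  have hnc : ∀ j, deg φ (u j) = 3 → ¬ IsCenterStarAt φ (u j) := fun j hd hcen => by
    have h1 := (coreExcess_of_isCenterStarAt (hu.mem_core j) hcen).2
    have := hs _ (hu.mem_core j)
    omega
  have hs0 := hs _ (hu.mem_core 0)
  have hs1 := hs _ (hu.mem_core 1)
  have hs2 := hs _ (hu.mem_core 2)
  have l1 := leafCharge_le_charge hk (hu.mem_core 1) hs1 (hnc 1 d1)
  have l2 := leafCharge_le_charge hk (hu.mem_core 2) hs2 (hnc 2 d2)
  -- Otherwise all three charges are at least `leafCharge k`; three times this exceeds the bound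
  -- 75.461 or 79.91.
  have hcen : IsCenterStarAt φ (u 0) := by
    by_contra hcon
    have l0 := leafCharge_le_charge hk (hu.mem_core 0) hs0 hcon
    rcases hk with rfl | rfl
    · rw [Nat.cast_ofNat, h4] at l0 l1 l2
      norm_num at hle'' l0 l1 l2
      linarith
    · rw [Nat.cast_ofNat, h5] at l0 l1 l2
      norm_num at hle'' l0 l1 l2
      linarith
  have hch0 := charge_of_isCenterStarAt (hu.mem_core 0) hcen
  -- A centred star with one more vertex is already too dear. The margin is small for k = 4: at
  -- least 24.52 + 2 · 25.53 against 75.461.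
  have h0k : (hang φ (u 0)).card = k := by
    by_contra hne
    rcases hk with rfl | rfl
    · have := centerCharge_mono (s := 5) (t := (hang φ (u 0)).card) (by norm_num)
        (by exact_mod_cast (by omega : 5 ≤ (hang φ (u 0)).card))
      rw [Nat.cast_ofNat, h4] at l1 l2
      norm_num at hle'' l1 l2
      linarith [c5.1]
    · have := centerCharge_mono (s := 6) (t := (hang φ (u 0)).card) (by norm_num)
        (by exact_mod_cast (by omega : 6 ≤ (hang φ (u 0)).card))
      rw [Nat.cast_ofNat, h5] at l1 l2
      norm_num at hle'' l1 l2
      linarith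
  rw [h0k] at hch0
  have key : ∀ u : Fin 3 → V, IsTriangle φ u → (hang φ (u 0)).card = k → deg φ (u 1) = 3 →
      deg φ (u 2) = 3 → IsCenterStarAt φ (u 0) →
      charge φ (u 1) + charge φ (u 2) ≤ leafCharge k + zCharge (n - 2 * k : ℕ) →
      (hang φ (u 1)).card = k → IsLeafStarAt φ (u 1) ∧ IsZTreeAt φ (u 2) ∧
        (hang φ (u 2)).card = n - 2 * k := by
    intro u hu h0 d1 d2 hcen hle h1
    have hc := hu.sum_card
    rw [hV] at hc
    have h2 : (hang φ (u 2)).card = n - 2 * k := by omega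
    obtain ⟨a1, b1⟩ := charge_of_card_le_five (hu.mem_core 1) d1 (by omega)
    obtain ⟨a2, b2⟩ := charge_of_six_le (hu.mem_core 2) d2 (by omega)
    rw [h1] at a1 b1
    rw [h2] at a2 b2
    exact ⟨b1 (by linarith), b2 (by linarith), h2⟩
  by_cases h1k : (hang φ (u 1)).card = k
  · obtain ⟨k1, k2, k3⟩ := key u hu h0k d1 d2 hcen (by linarith) h1k
    exact ⟨u, hu, h0k, h1k, k3, hcen, k1, k2⟩
  by_cases h2k : (hang φ (u 2)).card = k
  · have e0 : (u ∘ Equiv.swap 1 2) 0 = u 0 := by simp [Equiv.swap_apply_of_ne_of_ne]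
    have e1 : (u ∘ Equiv.swap 1 2) 1 = u 2 := by simp
    have e2 : (u ∘ Equiv.swap 1 2) 2 = u 1 := by simp
    obtain ⟨k1, k2, k3⟩ := key (u ∘ Equiv.swap 1 2) (hu.comp _) (by rw [e0, h0k]) (by rw [e1, d2])
      (by rw [e2, d1]) (by rw [e0]; exact hcen) (by rw [e1, e2]; linarith) (by rw [e1, h2k])
    exact ⟨u ∘ Equiv.swap 1 2, hu.comp _, by rw [e0, h0k], by rw [e1, h2k], k3,
      by rw [e0]; exact hcen, k1, k2⟩
  -- Both remaining trees have more than `k` vertices. For k = 4 each costs at least `leafCharge 5`.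
  -- For k = 5 one costs more than 729/64 + 16 > `leafCharge 5`, and the other, having at most n -
  -- 10 vertices, at least as much as the `Z` tree of the optimum.
  exfalso
  rcases hk with rfl | rfl
  · have l1' := leafCharge_le_charge (Or.inr rfl) (hu.mem_core 1)
      (by omega : 5 ≤ (hang φ (u 1)).card) (hnc 1 d1)
    have l2' := leafCharge_le_charge (Or.inr rfl) (hu.mem_core 2)
      (by omega : 5 ≤ (hang φ (u 2)).card) (hnc 2 d2)
    rw [Nat.cast_ofNat] at hch0
    rw [Nat.cast_ofNat, h5] at l1' l2'
    norm_num at hle'' l1' l2'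
    linarith
  · have a1 := (charge_of_six_le (hu.mem_core 1) d1 (by omega)).1
    have a2 := (charge_of_six_le (hu.mem_core 2) d2 (by omega)).1
    have a3 := zCharge_lt (s := (hang φ (u 1)).card)
      (by exact_mod_cast (by omega : 3 < (hang φ (u 1)).card))
    have a4 := zCharge_anti (s := (hang φ (u 2)).card) (t := (n - 2 * 5 : ℕ))
      (by exact_mod_cast (by omega : 3 < (hang φ (u 2)).card))
      (by exact_mod_cast (by omega : (hang φ (u 2)).card ≤ n - 2 * 5))
    rw [Nat.cast_ofNat] at hch0
    rw [Nat.cast_ofNat, h5] at hle'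
    linarith

end ParentMap

/-! ### Invariance under isomorphism. -/

section Transport

variable {V W : Type*} {G : SimpleGraph V} {H : SimpleGraph W}

lemma SimpleGraph.Iso.augmentedZagrebIndex_eq [Fintype V] [Fintype W] (e : G ≃g H) :
    augmentedZagrebIndex G = augmentedZagrebIndex H := by
  classical
  unfold augmentedZagrebIndex
  refine Finset.sum_nbij (Sym2.map e) ?_ ((Sym2.map.injective e.injective).injOn) ?_ ?_
  · intro x hx
    induction x with
    | _ a b => simpa [e.map_adj_iff] using hx
  · intro x hx
    induction x with
    | _ a b =>
      refine ⟨s(e.symm a, e.symm b), ?_, by simp⟩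
      simpa [e.symm.map_adj_iff] using hx
  · intro x _
    induction x with
    | _ a b => simp [e.degree_eq]

lemma IsUnicyclic.of_iso (e : G ≃g H) (h : IsUnicyclic G) : IsUnicyclic H := by
  refine ⟨e.connected_iff.1 h.1, ?_⟩
  rw [← Nat.card_congr e.toEquiv, ← h.2, ← Nat.card_coe_set_eq, ← Nat.card_coe_set_eq]
  exact (Nat.card_congr e.mapEdgeSet).symm

lemma SimpleGraph.Iso.isTree_induce_compl_map (e : G ≃g H) (X : Finset V) :
    (G.induce {v | v ∉ X}).IsTree ↔ (H.induce {v | v ∉ X.map e.toEquiv.toEmbedding}).IsTree := by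
  have heq : ∀ v, v ∈ {v | v ∉ X} ↔ e.toEquiv v ∈ {v | v ∉ X.map e.toEquiv.toEmbedding} := by
    exact fun v => not_congr (Finset.mem_map' _).symm
  exact SimpleGraph.Iso.isTree_iff ⟨e.toEquiv.subtypeEquiv heq, fun {a b} => e.map_adj_iff⟩

lemma IsApexTree.of_iso {k : ℕ} (e : G ≃g H) (h : IsApexTree k G) : IsApexTree k H := by
  obtain ⟨hc, ⟨X, hX, hT⟩, hmin⟩ := h
  refine ⟨e.connected_iff.1 hc, ⟨X.map e.toEquiv.toEmbedding, by rw [Finset.card_map, hX],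
    (e.isTree_induce_compl_map X).1 hT⟩, fun Y hY hTY => ?_⟩
  exact hmin _ (by rwa [Finset.card_map]) ((e.symm.isTree_induce_compl_map Y).1 hTY)

/-- A graph on `W` that is the only minimizer up to isomorphism. -/
lemma hasMinAZI_iff_nonempty_iso [Fintype V] [Fintype W] {k : ℕ}
    (hcard : Fintype.card V = Fintype.card W) (hH : H ∈ unicyclicApexTrees W k)
    (huniq : ∀ G ∈ unicyclicApexTrees V k,
      augmentedZagrebIndex G ≤ augmentedZagrebIndex H → Nonempty (G ≃g H)) (G₀ : SimpleGraph V) :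
    HasMinAZI (unicyclicApexTrees V k) G₀ ↔ Nonempty (G₀ ≃g H) := by
  constructor
  · rintro ⟨hG, hmin⟩
    -- A copy of `H` on the vertex set `V` is needed as a competitor for `G₀`.
    let f : V ≃ W := Fintype.equivOfCardEq hcard
    let e : H.comap f ≃g H := SimpleGraph.Iso.comap f H
    refine huniq _ hG ?_
    rw [← e.augmentedZagrebIndex_eq]
    exact hmin _ ⟨hH.1.of_iso e.symm, hH.2.of_iso e.symm⟩
  · rintro ⟨e⟩
    refine ⟨⟨hH.1.of_iso e.symm, hH.2.of_iso e.symm⟩, fun G hG => ?_⟩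
    rw [e.augmentedZagrebIndex_eq]
    by_contra! hlt
    obtain ⟨e'⟩ := huniq G hG hlt.le
    exact hlt.ne e'.augmentedZagrebIndex_eq

end Transport

/-! ### Membership and index of the displayed graphs, and the conclusion. -/

open ParentMap

lemma mem_unicyclicApexTrees_triangleWithTrees {T : Fin 3 → (q : ℕ) → SimpleGraph (Fin q)}
    {s : Fin 3 → ℕ} {par : Fin 3 → ℕ → ℕ} (hT : ∀ i, IsParent (T i (s i)) (par i)) {k : ℕ}
    (hk : 0 < k) (hs : ∀ i, k ≤ s i) (hex : ∃ i, s i = k) :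
    triangleWithTrees T s ∈ unicyclicApexTrees (Σ i : Fin 3, Fin (s i)) k := by
  have h := isOrientedBy_triangleMap (hs := fun i => hk.trans_le (hs i))
    (hpar := fun i => (hT i).lt) hT
  have hu := isTriangle_triangleMap (hs := fun i => hk.trans_le (hs i))
    (hpar := fun i => (hT i).lt)
  refine ⟨h.isUnicyclic, (h.isApexTree_iff k).2 ⟨fun v hv => ?_, ?_⟩⟩
  · obtain ⟨i, rfl⟩ := (hu.mem_core_iff v).1 hv
    rw [card_hang_triangleMap]
    exact hs i
  · obtain ⟨i, hi⟩ := hex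
    exact ⟨_, hu.mem_core i, by rw [card_hang_triangleMap, hi]⟩

lemma card_sigma_fin (s : Fin 3 → ℕ) :
    Fintype.card (Σ i : Fin 3, Fin (s i)) = s 0 + s 1 + s 2 := by
  rw [Fintype.card_sigma, Fin.sum_univ_three]
  simp

lemma augmentedZagrebIndex_graphA {s₁ s₂ s₃ : ℕ} (h₁ : 4 ≤ s₁) (h₂ : 4 ≤ s₂) (h₃ : 4 ≤ s₃) :
    augmentedZagrebIndex (graphA s₁ s₂ s₃) =
      (s₁ + s₂ + s₃ : ℕ) + (zCharge s₁ + zCharge s₂ + zCharge s₃) := by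
  have hT : ∀ i, IsParent ((![zTree, zTree, zTree] i) (![s₁, s₂, s₃] i))
      (![zPar, zPar, zPar] i) := by
    intro i; fin_cases i <;> exact isParent_zTree _
  have hs : ∀ i, 0 < ![s₁, s₂, s₃] i := by intro i; fin_cases i <;> simp <;> omega
  have h := isOrientedBy_triangleMap (hs := hs) (hpar := fun i => (hT i).lt) hT
  have hu := isTriangle_triangleMap (hs := hs) (hpar := fun i => (hT i).lt)
  have z0 := isZTreeAt_triangleMap (hs := hs) (hpar := fun i => (hT i).lt) (i := 0) rfl h₁
  have z1 := isZTreeAt_triangleMap (hs := hs) (hpar := fun i => (hT i).lt) (i := 1) rfl h₂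
  have z2 := isZTreeAt_triangleMap (hs := hs) (hpar := fun i => (hT i).lt) (i := 2) rfl h₃
  rw [graphA, hu.augmentedZagrebIndex_eq_charge h (coreExcess_of_isZTreeAt (hu.mem_core 1) z1).2
    (coreExcess_of_isZTreeAt (hu.mem_core 2) z2).2, charge_of_isZTreeAt (hu.mem_core 0) z0,
    charge_of_isZTreeAt (hu.mem_core 1) z1, charge_of_isZTreeAt (hu.mem_core 2) z2,
    card_hang_triangleMap, card_hang_triangleMap, card_hang_triangleMap, card_sigma_fin]
  rfl

lemma augmentedZagrebIndex_graphB {s₁ s₂ s₃ : ℕ} (h₁ : 2 ≤ s₁) (h₂ : 4 ≤ s₂) (h₃ : 4 ≤ s₃) :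
    augmentedZagrebIndex (graphB s₁ s₂ s₃) =
      (s₁ + s₂ + s₃ : ℕ) + (centerCharge s₁ + zCharge s₂ + zCharge s₃) := by
  have hT : ∀ i, IsParent ((![centerStar, zTree, zTree] i) (![s₁, s₂, s₃] i))
      (![centerPar, zPar, zPar] i) := by
    intro i
    fin_cases i
    exacts [isParent_centerStar _, isParent_zTree _, isParent_zTree _]
  have hs : ∀ i, 0 < ![s₁, s₂, s₃] i := by intro i; fin_cases i <;> simp <;> omega
  have h := isOrientedBy_triangleMap (hs := hs) (hpar := fun i => (hT i).lt) hT
  have hu := isTriangle_triangleMap (hs := hs) (hpar := fun i => (hT i).lt)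
  have z0 := isCenterStarAt_triangleMap (hs := hs) (hpar := fun i => (hT i).lt) (i := 0) rfl
  have z1 := isZTreeAt_triangleMap (hs := hs) (hpar := fun i => (hT i).lt) (i := 1) rfl h₂
  have z2 := isZTreeAt_triangleMap (hs := hs) (hpar := fun i => (hT i).lt) (i := 2) rfl h₃
  rw [graphB, hu.augmentedZagrebIndex_eq_charge h (coreExcess_of_isZTreeAt (hu.mem_core 1) z1).2
    (coreExcess_of_isZTreeAt (hu.mem_core 2) z2).2, charge_of_isCenterStarAt (hu.mem_core 0) z0,
    charge_of_isZTreeAt (hu.mem_core 1) z1, charge_of_isZTreeAt (hu.mem_core 2) z2,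
    card_hang_triangleMap, card_hang_triangleMap, card_hang_triangleMap, card_sigma_fin]
  rfl

lemma augmentedZagrebIndex_graphC {s₁ s₂ s₃ : ℕ} (h₁ : 2 ≤ s₁) (h₂ : 3 ≤ s₂) (h₃ : 4 ≤ s₃) :
    augmentedZagrebIndex (graphC s₁ s₂ s₃) =
      (s₁ + s₂ + s₃ : ℕ) + (centerCharge s₁ + leafCharge s₂ + zCharge s₃) := by
  have hT : ∀ i, IsParent ((![centerStar, leafStar, zTree] i) (![s₁, s₂, s₃] i))
      (![centerPar, leafPar, zPar] i) := by
    intro i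
    fin_cases i
    exacts [isParent_centerStar _, isParent_leafStar _, isParent_zTree _]
  have hs : ∀ i, 0 < ![s₁, s₂, s₃] i := by intro i; fin_cases i <;> simp <;> omega
  have h := isOrientedBy_triangleMap (hs := hs) (hpar := fun i => (hT i).lt) hT
  have hu := isTriangle_triangleMap (hs := hs) (hpar := fun i => (hT i).lt)
  have z0 := isCenterStarAt_triangleMap (hs := hs) (hpar := fun i => (hT i).lt) (i := 0) rfl
  have z1 := isLeafStarAt_triangleMap (hs := hs) (hpar := fun i => (hT i).lt) (i := 1) rfl h₂
  have z2 := isZTreeAt_triangleMap (hs := hs) (hpar := fun i => (hT i).lt) (i := 2) rfl h₃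
  rw [graphC, hu.augmentedZagrebIndex_eq_charge h (coreExcess_of_isLeafStarAt (hu.mem_core 1) z1).2
    (coreExcess_of_isZTreeAt (hu.mem_core 2) z2).2, charge_of_isCenterStarAt (hu.mem_core 0) z0,
    charge_of_isLeafStarAt (hu.mem_core 1) z1, charge_of_isZTreeAt (hu.mem_core 2) z2,
    card_hang_triangleMap, card_hang_triangleMap, card_hang_triangleMap, card_sigma_fin]
  rfl

lemma exists_isOrientedBy_hasMinHang {V : Type*} [Fintype V] {k : ℕ} {G : SimpleGraph V}
    (hG : G ∈ unicyclicApexTrees V k) : ∃ φ, G.IsOrientedBy φ ∧ HasMinHang φ k := by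
  obtain ⟨φ, h⟩ := hG.1.exists_isOrientedBy
  exact ⟨φ, h, (h.isApexTree_iff k).1 hG.2⟩

theorem proposition3p1 {V : Type*} [Fintype V] (n k : ℕ) (hV : Fintype.card V = n)
    (hn : 3 * k + 3 ≤ n) (G₀ : SimpleGraph V) :
    (7 ≤ k → (HasMinAZI (unicyclicApexTrees V k) G₀ ↔
      Nonempty (G₀ ≃g graphA k ((n - k) / 2) ((n - k + 1) / 2)))) ∧
    (k = 6 → (HasMinAZI (unicyclicApexTrees V k) G₀ ↔
      Nonempty (G₀ ≃g graphB 6 (n / 2 - 3) ((n + 1) / 2 - 3)))) ∧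
    (4 ≤ k ∧ k ≤ 5 → (HasMinAZI (unicyclicApexTrees V k) G₀ ↔
      Nonempty (G₀ ≃g graphC k k (n - 2 * k)))) := by
  refine ⟨fun hk => ?_, fun hk => ?_, fun hk => ?_⟩
  · have hT : ∀ i, IsParent ((![zTree, zTree, zTree] i)
        (![k, (n - k) / 2, (n - k + 1) / 2] i)) (![zPar, zPar, zPar] i) := by
      intro i; fin_cases i <;> exact isParent_zTree _
    have hsum : k + (n - k) / 2 + (n - k + 1) / 2 = n := by omega
    refine hasMinAZI_iff_nonempty_iso ?_ ?_ ?_ G₀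
    · rw [hV, card_sigma_fin]; exact hsum.symm
    · exact mem_unicyclicApexTrees_triangleWithTrees hT (by omega)
        (by intro i; fin_cases i <;> simp <;> omega) ⟨0, rfl⟩
    · intro G hG hle
      obtain ⟨φ, h, hmin⟩ := exists_isOrientedBy_hasMinHang hG
      rw [augmentedZagrebIndex_graphA (by omega) (by omega) (by omega), hsum] at hle
      obtain ⟨u, hu, h0, h1, h2, hz⟩ := exists_zTree_zTree_zTree hV hn hk h hmin hle
      refine nonempty_iso_triangleWithTrees h hu hT fun i => ?_
      have hi := hangIso_of_isZTreeAt (hz i)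
      fin_cases i
      · exact h0 ▸ hi
      · exact h1 ▸ hi
      · exact h2 ▸ hi
  · subst hk
    have hT : ∀ i, IsParent ((![centerStar, zTree, zTree] i)
        (![6, n / 2 - 3, (n + 1) / 2 - 3] i)) (![centerPar, zPar, zPar] i) := by
      intro i
      fin_cases i
      exacts [isParent_centerStar _, isParent_zTree _, isParent_zTree _]
    have hsum : 6 + (n / 2 - 3) + ((n + 1) / 2 - 3) = n := by omega
    refine hasMinAZI_iff_nonempty_iso ?_ ?_ ?_ G₀
    · rw [hV, card_sigma_fin]; exact hsum.symm
    · exact mem_unicyclicApexTrees_triangleWithTrees hT (by omega)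
        (by intro i; fin_cases i <;> simp <;> omega) ⟨0, rfl⟩
    · intro G hG hle
      obtain ⟨φ, h, hmin⟩ := exists_isOrientedBy_hasMinHang hG
      rw [augmentedZagrebIndex_graphB (by omega) (by omega) (by omega), hsum, Nat.cast_ofNat] at hle
      obtain ⟨u, hu, h0, h1, h2, c0, z1, z2⟩ :=
        exists_centerStar_zTree_zTree hV (by omega) h hmin hle
      refine nonempty_iso_triangleWithTrees h hu hT fun i => ?_
      fin_cases i
      · exact h0 ▸ hangIso_of_isCenterStarAt c0
      · exact h1 ▸ hangIso_of_isZTreeAt z1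
      · exact h2 ▸ hangIso_of_isZTreeAt z2
  · have hT : ∀ i, IsParent ((![centerStar, leafStar, zTree] i)
        (![k, k, n - 2 * k] i)) (![centerPar, leafPar, zPar] i) := by
      intro i
      fin_cases i
      exacts [isParent_centerStar _, isParent_leafStar _, isParent_zTree _]
    have hsum : k + k + (n - 2 * k) = n := by omega
    refine hasMinAZI_iff_nonempty_iso ?_ ?_ ?_ G₀
    · rw [hV, card_sigma_fin]; exact hsum.symm
    · exact mem_unicyclicApexTrees_triangleWithTrees hT (by omega)
        (by intro i; fin_cases i <;> simp <;> omega) ⟨0, rfl⟩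
    · intro G hG hle
      obtain ⟨φ, h, hmin⟩ := exists_isOrientedBy_hasMinHang hG
      rw [augmentedZagrebIndex_graphC (by omega) (by omega) (by omega), hsum] at hle
      obtain ⟨u, hu, h0, h1, h2, c0, l1, z2⟩ :=
        exists_centerStar_leafStar_zTree hV hn (by omega) h hmin hle
      refine nonempty_iso_triangleWithTrees h hu hT fun i => ?_
      fin_cases i
      · have hi := hangIso_of_isCenterStarAt c0
        rw [h0] at hi
        exact hi
      · have hi := hangIso_of_isLeafStarAt l1
        rw [h1] at hi
        exact hi
      · have hi := hangIso_of_isZTreeAt z2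
        rw [h2] at hi
        exact hi
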